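/- Let $d,n\ge 1$ and $k\ge 0$ be integers, $\varepsilon\in(0,\frac15]$, let $P$ be a family of $n$ points in $\mathbb{R}^d$, and let $\alpha\in I:=\{(1+\varepsilon)^i \mid i\in\mathbb{Z}\}$. For a scale $\alpha$ let $\beta(\alpha)$ be the largest power $2^i$ ($i\in\mathbb{Z}$) with $2^i\le\alpha$, and call the closed cubes $s\,(z+[0,1]^d)$, $z\in\mathbb{Z}^d$, with $s=\frac{\varepsilon\,\beta(\alpha)}{4\sqrt d}$, the pixels of the grid at scale $\alpha$. Let $S_\alpha$ be the set of those pixels of this grid whose center $s\,(z+(\frac12,\dots,\frac12))$ has Euclidean distance at most $\alpha$ to some point of $P$, and let $\mathcal{X}_\alpha$ be the nerve of $S_\alpha$. The simplicial map $g:\mathcal{X}_\alpha\to\mathcal{X}_{(1+\varepsilon)\alpha}$ connecting the scale $\alpha$ to the next scale sends each pixel of $S_\alpha$ to the unique pixel of $S_{(1+\varepsilon)\alpha}$ that contains it. Then the $k$-skeleton of $\mathcal{X}_\alpha$ and the map $g$ can be computed in time $$n\left(\frac1\varepsilon\right)^d 2^{O(d\log d+dk)}.$$ Precisely: there are a program for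 the real RAM and a constant $c$ (one program and one constant for all $d,n,k,\varepsilon,\alpha,P$) such that, on input $d,n,k,\varepsilon,\alpha$ and the coordinates of the points of $P$, the program halts after at most $$c\,n\left(\frac1\varepsilon\right)^d 2^{\,c\,(d\log d+dk)}$$ steps and outputs the list of all pixels of $S_\alpha$ (each once, by its integer vector $z$), the list of all nonempty simplices of $\mathcal{X}_\alpha$ of dimension at most $k$ (each once, by its set of vertices), and for each pixel $C\in S_\alpha$ the integer vector, in the grid of scale $(1+\varepsilon)\alpha$, of the pixel $g(C)$; this map $g$ exists and maps simplices to simplices. Here a real RAM has registers and zero-initialized arrays that hold exact real numbers, and each of the following takes one step: memory access with indirect addressing, $+,-,\times,\div$, square root, $\exp$, $\log$, floor, comparison, and each control step. -/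

import Mathlib

/-! ### A real RAM with a step count

Programs over an exact real-number memory: finitely many scalar registers and finitely many
one-dimensional arrays are named by a program, and array cells are addressed indirectly.
Every arithmetic operation, root, logarithm, exponential, floor, comparison, memory access and
control step costs one time unit. -/

namespace RealRAM

/-- The memory: scalar registers and arrays of real numbers. -/
@[ext] structure Mem where
  reg : ℕ → ℝ
  arr : ℕ → ℕ → ℝ

/-- Write a scalar register. -/
def Mem.setReg (m : Mem) (r : ℕ) (x : ℝ) : Mem :=
  { m with reg := Function.update m.reg r x }

/-- Write cell `j` of array `a`. -/
def Mem.setArr (m : Mem) (a j : ℕ) (x : ℝ) : Mem :=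
  { m with arr := Function.update m.arr a (Function.update (m.arr a) j x) }

/-- Arithmetic expressions; `cell a e` is indirect addressing into array `a`. -/
inductive Expr where
  | const (z : ℤ)
  | reg (r : ℕ)
  | cell (a : ℕ) (e : Expr)
  | add (e f : Expr)
  | sub (e f : Expr)
  | mul (e f : Expr)
  | div (e f : Expr)
  | sqrt (e : Expr)
  | exp (e : Expr)
  | log (e : Expr)
  | floor (e : Expr)

/-- The value of an expression. An address is rounded down to a natural number (a negative one
to `0`); outside their natural domains the operations return the total conventions of Mathlib
(for instance `x / 0 = 0`). -/
noncomputable def Expr.eval (m : Mem) : Expr → ℝ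
  | const z => (z : ℝ)
  | reg r => m.reg r
  | cell a e => m.arr a ⌊e.eval m⌋₊
  | add e f => e.eval m + f.eval m
  | sub e f => e.eval m - f.eval m
  | mul e f => e.eval m * f.eval m
  | div e f => e.eval m / f.eval m
  | sqrt e => Real.sqrt (e.eval m)
  | exp e => Real.exp (e.eval m)
  | log e => Real.log (e.eval m)
  | floor e => (⌊e.eval m⌋ : ℝ)

/-- The time to evaluate an expression: one unit per constant, memory access and operation. -/
def Expr.cost : Expr → ℕ
  | const _ => 1
  | reg _ => 1
  | cell _ e => e.cost + 1
  | add e f => e.cost + f.cost + 1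
  | sub e f => e.cost + f.cost + 1
  | mul e f => e.cost + f.cost + 1
  | div e f => e.cost + f.cost + 1
  | sqrt e => e.cost + 1
  | exp e => e.cost + 1
  | log e => e.cost + 1
  | floor e => e.cost + 1

/-- Comparisons of two real numbers. -/
inductive Test where
  | le (e f : Expr)
  | lt (e f : Expr)
  | eq (e f : Expr)

def Test.Holds (m : Mem) : Test → Prop
  | le e f => e.eval m ≤ f.eval m
  | lt e f => e.eval m < f.eval m
  | eq e f => e.eval m = f.eval m

def Test.cost : Test → ℕ
  | le e f => e.cost + f.cost + 1
  | lt e f => e.cost + f.cost + 1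
  | eq e f => e.cost + f.cost + 1

/-- Structured programs. A program is a finite object, so it has finite control, and it names
finitely many registers, arrays and integer constants. -/
inductive Prog where
  | skip
  | set (r : ℕ) (e : Expr)
  | store (a : ℕ) (idx e : Expr)
  | seq (p q : Prog)
  | ite (b : Test) (p q : Prog)
  | while (b : Test) (p : Prog)

/-- `Runs p m m' t`: started with memory `m`, the program `p` halts after exactly `t` time units
with memory `m'`. -/
inductive Runs : Prog → Mem → Mem → ℕ → Prop
  | skip (m : Mem) : Runs .skip m m 1
  | set (m : Mem) (r : ℕ) (e : Expr) :
      Runs (.set r e) m (m.setReg r (e.eval m)) (e.cost + 1)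
  | store (m : Mem) (a : ℕ) (idx e : Expr) :
      Runs (.store a idx e) m (m.setArr a ⌊idx.eval m⌋₊ (e.eval m)) (idx.cost + e.cost + 1)
  | seq {p q : Prog} {m m₁ m₂ : Mem} {s t : ℕ} (hp : Runs p m m₁ s) (hq : Runs q m₁ m₂ t) :
      Runs (.seq p q) m m₂ (s + t + 1)
  | ite_true {b : Test} {p : Prog} (q : Prog) {m m₁ : Mem} {t : ℕ} (hb : b.Holds m)
      (hp : Runs p m m₁ t) : Runs (.ite b p q) m m₁ (b.cost + t + 1)
  | ite_false {b : Test} (p : Prog) {q : Prog} {m m₁ : Mem} {t : ℕ} (hb : ¬ b.Holds m)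
      (hq : Runs q m m₁ t) : Runs (.ite b p q) m m₁ (b.cost + t + 1)
  | while_false {b : Test} (p : Prog) {m : Mem} (hb : ¬ b.Holds m) :
      Runs (.while b p) m m (b.cost + 1)
  | while_true {b : Test} {p : Prog} {m m₁ m₂ : Mem} {s t : ℕ} (hb : b.Holds m)
      (hp : Runs p m m₁ s) (hw : Runs (.while b p) m₁ m₂ t) :
      Runs (.while b p) m m₂ (b.cost + s + t + 1)

end RealRAM

/-! ### The approximation complex -/

namespace PixelTower

/-- The scales `(1 + ε) ^ i`, `i ∈ ℤ`. -/
def scales (ε : ℝ) : Set ℝ := Set.range fun i : ℤ => (1 + ε) ^ i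

/-- The integer powers of two. -/
def dyadic : Set ℝ := Set.range fun i : ℤ => (2 : ℝ) ^ i

/-- The largest integer power of two that is at most `α`, for `α > 0`
(see `isGreatest_gridScale`). -/
noncomputable def gridScale (α : ℝ) : ℝ := (2 : ℝ) ^ Int.log 2 α

theorem isGreatest_gridScale {α : ℝ} (hα : 0 < α) :
    IsGreatest {β | β ∈ dyadic ∧ β ≤ α} (gridScale α) := by
  refine ⟨⟨⟨_, rfl⟩, ?_⟩, ?_⟩
  · exact_mod_cast Int.zpow_log_le_self (b := 2) one_lt_two hα
  · rintro _ ⟨⟨i, rfl⟩, hi⟩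
    have h : i ≤ Int.log 2 α :=
      (Int.zpow_le_iff_le_log (b := 2) one_lt_two hα).1 (by exact_mod_cast hi)
    exact zpow_le_zpow_right₀ one_le_two h

/-- The side length of the pixels used at scale `α` in dimension `d`. -/
noncomputable def side (d : ℕ) (ε α : ℝ) : ℝ := ε * gridScale α / (4 * Real.sqrt d)

/-- The pixel of the lattice `s ℤ^d` with lowest corner `s z`. -/
def pixel {d : ℕ} (s : ℝ) (z : Fin d → ℤ) : Set (EuclideanSpace ℝ (Fin d)) :=
  {x | ∀ l, s * z l ≤ x l ∧ x l ≤ s * (z l + 1)}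

/-- The center of `pixel s z`. -/
noncomputable def center {d : ℕ} (s : ℝ) (z : Fin d → ℤ) : EuclideanSpace ℝ (Fin d) :=
  WithLp.toLp 2 fun l => s * (z l + 1 / 2)

/-- The pixels at scale `α`: those whose center is at distance at most `α` from a point of
`P`. -/
def pixels {d n : ℕ} (ε : ℝ) (P : Fin n → EuclideanSpace ℝ (Fin d)) (α : ℝ) :
    Set (Set (EuclideanSpace ℝ (Fin d))) :=
  {C | ∃ z : Fin d → ℤ, C = pixel (side d ε α) z ∧
    ∃ a : Fin n, dist (center (side d ε α) z) (P a) ≤ α}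

/-- The nerve of a collection of sets. -/
def nerve {E : Type*} (S : Set (Set E)) : PreAbstractSimplicialComplex (Set E) where
  faces := {σ | σ.Nonempty ∧ (σ : Set (Set E)) ⊆ S ∧ (⋂ C ∈ σ, C).Nonempty}
  isRelLowerSet_faces := by
    rintro σ ⟨hne, hS, hi⟩
    refine ⟨hne, fun τ hτ hτne => ⟨hτne, ?_, ?_⟩⟩
    · exact (Finset.coe_subset.2 hτ).trans hS
    · exact hi.mono (Set.biInter_subset_biInter_left hτ)

/-- The `k`-skeleton: the simplices of dimension at most `k`. -/
def skeleton {V : Type*} (k : ℕ) (K : PreAbstractSimplicialComplex V) :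
    PreAbstractSimplicialComplex V where
  faces := {σ | σ ∈ K.faces ∧ σ.card ≤ k + 1}
  isRelLowerSet_faces := by
    rintro σ ⟨hσ, hc⟩
    exact ⟨(K.isRelLowerSet_faces hσ).1, fun τ hτ hne =>
      ⟨(K.isRelLowerSet_faces hσ).2 hτ hne, (Finset.card_le_card hτ).trans hc⟩⟩

/-- The approximation complex at scale `α`. -/
def approxComplex {d n : ℕ} (ε : ℝ) (P : Fin n → EuclideanSpace ℝ (Fin d)) (α : ℝ) :
    PreAbstractSimplicialComplex (Set (EuclideanSpace ℝ (Fin d))) :=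
  nerve (pixels ε P α)

open Classical in
/-- `g` is the vertex map of the connecting simplicial map from scale `α` to the next scale
`(1 + ε) α`: every pixel at scale `α` goes to the unique pixel at the next scale that contains
it, and simplices go to simplices. -/
structure IsConnectingMap {d n : ℕ} (ε : ℝ) (P : Fin n → EuclideanSpace ℝ (Fin d)) (α : ℝ)
    (g : Set (EuclideanSpace ℝ (Fin d)) → Set (EuclideanSpace ℝ (Fin d))) : Prop where
  mem : ∀ C ∈ pixels ε P α, g C ∈ pixels ε P ((1 + ε) * α)
  subset : ∀ C ∈ pixels ε P α, C ⊆ g C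
  unique : ∀ C ∈ pixels ε P α, ∀ C' ∈ pixels ε P ((1 + ε) * α), C ⊆ C' → C' = g C
  simplicial : ∀ σ ∈ (approxComplex ε P α).faces,
    σ.image g ∈ (approxComplex ε P ((1 + ε) * α)).faces

/-! ### Input and output of the computation -/

/-- The initial memory: registers `0, …, 4` hold `d, n, k, ε, α`, array `0` holds the coordinates
of the points row by row, and every other cell holds `0`. -/
noncomputable def inputMem {d n : ℕ} (k : ℕ) (ε α : ℝ)
    (P : Fin n → EuclideanSpace ℝ (Fin d)) : RealRAM.Mem where
  reg := fun r =>
    if r = 0 then d else if r = 1 then n else if r = 2 then k else if r = 3 then ε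
    else if r = 4 then α else 0
  arr := fun a j =>
    if h : a = 0 ∧ j / d < n ∧ 0 < d then P ⟨j / d, h.2.1⟩ ⟨j % d, Nat.mod_lt j h.2.2⟩ else 0

/-- The memory `m` holds the following report:
* register `0` holds the number `N` of listed pixels, and row `a` of array `1` holds the lattice
  coordinates `pix a` of the `a`-th pixel;
* register `1` holds the number `M` of listed simplices, cell `b` of array `2` the number of
  vertices of the `b`-th simplex, and row `b` of array `3` (rows of width `k + 1`) the increasing
  list of the indices of its vertices;
* row `a` of array `4` holds the lattice coordinates `img a` of the image of the `a`-th pixel in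
  the lattice of the next scale. -/
structure Holds (m : RealRAM.Mem) (d k : ℕ) {N M : ℕ} (pix : Fin N → Fin d → ℤ)
    (simp : Fin M → Finset (Fin N)) (img : Fin N → Fin d → ℤ) : Prop where
  pix_count : m.reg 0 = N
  pix_coord : ∀ (a : Fin N) (l : Fin d), m.arr 1 (a * d + l) = pix a l
  simp_count : m.reg 1 = M
  simp_card : ∀ b : Fin M, m.arr 2 b = (simp b).card
  simp_vertex : ∀ (b : Fin M) (t : Fin (simp b).card),
    m.arr 3 (b * (k + 1) + t) = ((simp b).orderEmbOfFin rfl t : Fin N).val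
  img_coord : ∀ (a : Fin N) (l : Fin d), m.arr 4 (a * d + l) = img a l

open Classical in
/-- The memory `m` holds the `k`-skeleton of the approximation complex at scale `α` (each pixel
and each simplex listed exactly once) and the connecting simplicial map to the next scale. -/
def HoldsSkeletonAndMap {d n : ℕ} (m : RealRAM.Mem) (k : ℕ) (ε α : ℝ)
    (P : Fin n → EuclideanSpace ℝ (Fin d)) : Prop :=
  ∃ (N M : ℕ) (pix : Fin N → Fin d → ℤ) (simp : Fin M → Finset (Fin N))
    (img : Fin N → Fin d → ℤ),
    Holds m d k pix simp img ∧
    Set.BijOn (fun a => pixel (side d ε α) (pix a)) Set.univ (pixels ε P α) ∧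
    Set.BijOn (fun b => (simp b).image fun a => pixel (side d ε α) (pix a)) Set.univ
      (skeleton k (approxComplex ε P α)).faces ∧
    ∃ g, IsConnectingMap ε P α g ∧
      ∀ a, g (pixel (side d ε α) (pix a)) = pixel (side d ε ((1 + ε) * α)) (img a)

end PixelTower

/-!
The program enumerates a superset of the wanted objects, tests each candidate, and removes
repetitions with tables that are addressed directly.

*Tables.* The cells of an array are addressed by arbitrary natural numbers and are zero initially,
so an injective numbering of the keys gives a dictionary with one access per query, and no sorting
(hence no factor `log n`) is needed. The numbering `code` of lists is the left fold of
`(h, c) ↦ (h + (c + 1)) ^ 2 + (c + 1)`, which costs a bounded number of operations per entry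
(`code_injective`); integers are numbered by `z ↦ z (2 z + 1)` (`intCode_injective`). The addresses
are very large, which the model does not charge for.

*Pixels.* Around each point the program tries a box of `K ^ d` lattice vectors, with
`K = ⌊2 α / s⌋ + 2 ≤ 18 d / ε` for the side length `s` (`exists_cand`, `width_le`), and keeps those
whose center is close enough to the point. The `c`-th vector is read off from the base-`K` digits
of `c`.

*Simplices.* Closed pixels of one grid have a common point if and only if they have a common
lattice point: the coordinatewise maximum `w` of their lattice vectors is one. The pixels that
contain `w` have the vectors `w - b` with `b ∈ {0, 1} ^ d`. So the program runs through the
`2 ^ d` lattice points at each listed pixel, looks up the at most `2 ^ d` pixels around it, and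
runs through all `(k + 1)`-tuples of them; from each tuple the increasing subsequence of
records is selected (`sel`), which yields every set of at most `k + 1` of these pixels
(`exists_sel_tuple_iff`). This is `n K ^ d 2 ^ {O(d + d k)}` work in total.

*The map.* The next grid has the same side or twice the side (`ratio_eq`), so the containing pixel
is found by rounding each coordinate down, and its center moves by at most `ε α`
(`dist_center_next`).

The program is verified with total-correctness triples `HT p m T Q` that carry a time bound:
loop-free code is executed symbolically (`HT.of_loopless`), bounded loops use an invariant
(`HT.forLoop`), and whatever a program does not write is unchanged (`Runs.frame`).
-/

/-! ### A total-correctness calculus for real RAM programs -/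

namespace RealRAM

instance : Add Expr := ⟨Expr.add⟩
instance : Sub Expr := ⟨Expr.sub⟩
instance : Mul Expr := ⟨Expr.mul⟩
instance : Div Expr := ⟨Expr.div⟩
instance (z : ℕ) : OfNat Expr z := ⟨Expr.const z⟩

namespace Expr

variable (m : Mem) (e f : Expr)

theorem eval_add : (e + f).eval m = e.eval m + f.eval m := rfl
theorem eval_sub : (e - f).eval m = e.eval m - f.eval m := rfl
theorem eval_mul : (e * f).eval m = e.eval m * f.eval m := rfl
theorem eval_div : (e / f).eval m = e.eval m / f.eval m := rfl
theorem eval_zero : (0 : Expr).eval m = 0 := by change ((0 : ℤ) : ℝ) = 0; simp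
theorem eval_one : (1 : Expr).eval m = 1 := by change ((1 : ℤ) : ℝ) = 1; simp
theorem eval_two : (2 : Expr).eval m = 2 := by change ((2 : ℤ) : ℝ) = 2; simp
theorem eval_four : (4 : Expr).eval m = 4 := by change ((4 : ℤ) : ℝ) = 4; simp
theorem eval_reg (r : ℕ) : (reg r).eval m = m.reg r := rfl
theorem eval_cell (a : ℕ) : (cell a e).eval m = m.arr a ⌊e.eval m⌋₊ := rfl
theorem eval_sqrt : (sqrt e).eval m = Real.sqrt (e.eval m) := rfl
theorem eval_exp : (exp e).eval m = Real.exp (e.eval m) := rfl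
theorem eval_log : (log e).eval m = Real.log (e.eval m) := rfl
theorem eval_floor : (floor e).eval m = (⌊e.eval m⌋ : ℝ) := rfl

end Expr

namespace Mem

theorem reg_setReg (m : Mem) (r r' : ℕ) (x : ℝ) :
    (m.setReg r x).reg r' = if r' = r then x else m.reg r' := by
  simp [setReg, Function.update_apply]

theorem arr_setReg (m : Mem) (r : ℕ) (x : ℝ) : (m.setReg r x).arr = m.arr := rfl

theorem reg_setArr (m : Mem) (a j : ℕ) (x : ℝ) : (m.setArr a j x).reg = m.reg := rfl

theorem arr_setArr (m : Mem) (a a' j j' : ℕ) (x : ℝ) :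
    (m.setArr a j x).arr a' j' = if a' = a ∧ j' = j then x else m.arr a' j' := by
  by_cases h : a' = a
  · subst h; simp [setArr, Function.update_apply]
  · simp [setArr, h]

end Mem

namespace Prog

/-- The registers that a program may write. -/
def wr : Prog → List ℕ
  | skip => []
  | set r _ => [r]
  | store _ _ _ => []
  | seq p q => p.wr ++ q.wr
  | ite _ p q => p.wr ++ q.wr
  | .while _ p => p.wr

/-- The arrays that a program may write. -/
def wa : Prog → List ℕ
  | skip => []
  | set _ _ => []
  | store a _ _ => [a]
  | seq p q => p.wa ++ q.wa
  | ite _ p q => p.wa ++ q.wa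
  | .while _ p => p.wa

/-- Whether a program contains no loop. -/
def loopless : Prog → Bool
  | seq p q => p.loopless && q.loopless
  | ite _ p q => p.loopless && q.loopless
  | .while _ _ => false
  | _ => true

/-- The longest running time of a loop-free program; the value at a loop is not used. -/
def time : Prog → ℕ
  | skip => 1
  | set _ e => e.cost + 1
  | store _ i e => i.cost + e.cost + 1
  | seq p q => p.time + q.time + 1
  | ite b p q => b.cost + max p.time q.time + 1
  | .while _ _ => 0

open Classical in
/-- The effect of a loop-free program; the value at a loop is not used. -/
noncomputable def exec : Prog → Mem → Mem
  | skip, m => m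
  | set r e, m => m.setReg r (e.eval m)
  | store a i e, m => m.setArr a ⌊i.eval m⌋₊ (e.eval m)
  | seq p q, m => q.exec (p.exec m)
  | ite b p q, m => if b.Holds m then p.exec m else q.exec m
  | .while _ _, m => m

/-- `for r < b do p`, where the bound `b` is a register. -/
def forLoop (r b : ℕ) (p : Prog) : Prog :=
  seq (set r 0) (.while (.lt (.reg r) (.reg b)) (seq p (set r (.reg r + 1))))

end Prog

/-- `m'` agrees with `m` on all registers and arrays that `p` does not write. -/
structure Frame (p : Prog) (m m' : Mem) : Prop where
  reg : ∀ r, r ∉ p.wr → m'.reg r = m.reg r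
  arr : ∀ a, a ∉ p.wa → m'.arr a = m.arr a

theorem Runs.frame {p : Prog} {m m' : Mem} {t : ℕ} (h : Runs p m m' t) : Frame p m m' := by
  induction h with
  | skip m => exact ⟨fun _ _ => rfl, fun _ _ => rfl⟩
  | set m r e =>
    refine ⟨fun r' h => ?_, fun _ _ => rfl⟩
    rw [Mem.reg_setReg, if_neg]; simpa [Prog.wr] using h
  | store m a i e =>
    refine ⟨fun _ _ => rfl, fun a' h => ?_⟩
    ext j
    rw [Mem.arr_setArr, if_neg]
    rintro ⟨h', -⟩
    exact h (by simp [Prog.wa, h'])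
  | seq _ _ ih₁ ih₂ =>
    refine ⟨fun r h => ?_, fun a h => ?_⟩
    · simp only [Prog.wr, List.mem_append, not_or] at h
      rw [ih₂.reg r h.2, ih₁.reg r h.1]
    · simp only [Prog.wa, List.mem_append, not_or] at h
      rw [ih₂.arr a h.2, ih₁.arr a h.1]
  | ite_true _ _ _ ih =>
    refine ⟨fun r h => ih.reg r ?_, fun a h => ih.arr a ?_⟩
    · simp only [Prog.wr, List.mem_append, not_or] at h; exact h.1
    · simp only [Prog.wa, List.mem_append, not_or] at h; exact h.1
  | ite_false _ _ _ ih =>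
    refine ⟨fun r h => ih.reg r ?_, fun a h => ih.arr a ?_⟩
    · simp only [Prog.wr, List.mem_append, not_or] at h; exact h.2
    · simp only [Prog.wa, List.mem_append, not_or] at h; exact h.2
  | while_false _ _ => exact ⟨fun _ _ => rfl, fun _ _ => rfl⟩
  | while_true _ _ _ ih₁ ih₂ =>
    refine ⟨fun r h => ?_, fun a h => ?_⟩
    · rw [ih₂.reg r h, ih₁.reg r h]
    · rw [ih₂.arr a h, ih₁.arr a h]

/-- Started with memory `m`, the program `p` halts within `T` steps with a memory that
satisfies `Q`. -/
def HT (p : Prog) (m : Mem) (T : ℕ) (Q : Mem → Prop) : Prop :=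
  ∃ m' t, Runs p m m' t ∧ t ≤ T ∧ Q m'

namespace HT

variable {p q : Prog} {m : Mem} {T T' : ℕ} {Q Q' : Mem → Prop}

theorem mono (h : HT p m T Q) (hT : T ≤ T') (hQ : ∀ m', Frame p m m' → Q m' → Q' m') :
    HT p m T' Q' := by
  obtain ⟨m', t, hr, ht, hq⟩ := h
  exact ⟨m', t, hr, ht.trans hT, hQ m' hr.frame hq⟩

theorem seq {T₁ T₂ : ℕ} (h : HT p m T₁ Q) (hT : T₁ + T₂ + 1 ≤ T)
    (h' : ∀ m', Frame p m m' → Q m' → HT q m' T₂ Q') : HT (.seq p q) m T Q' := by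
  obtain ⟨m', t, hr, ht, hq⟩ := h
  obtain ⟨m'', t', hr', ht', hq'⟩ := h' m' hr.frame hq
  exact ⟨m'', t + t' + 1, .seq hr hr', by omega, hq'⟩

/-- A loop-free program halts within `p.time` steps with the memory `p.exec m`. -/
theorem loopless_runs : ∀ (p : Prog) (m : Mem), p.loopless = true →
    ∃ t, Runs p m (p.exec m) t ∧ t ≤ p.time
  | .skip, m, _ => ⟨1, .skip m, le_rfl⟩
  | .set r e, m, _ => ⟨_, .set m r e, le_rfl⟩
  | .store a i e, m, _ => ⟨_, .store m a i e, le_rfl⟩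
  | .seq p q, m, h => by
    simp only [Prog.loopless, Bool.and_eq_true] at h
    obtain ⟨s, hs, hs'⟩ := loopless_runs p m h.1
    obtain ⟨t, ht, ht'⟩ := loopless_runs q (p.exec m) h.2
    exact ⟨s + t + 1, .seq hs ht, by simp only [Prog.time]; omega⟩
  | .ite b p q, m, h => by
    simp only [Prog.loopless, Bool.and_eq_true] at h
    by_cases hb : b.Holds m
    · obtain ⟨s, hs, hs'⟩ := loopless_runs p m h.1
      refine ⟨b.cost + s + 1, ?_, ?_⟩
      · simp only [Prog.exec, if_pos hb]; exact .ite_true q hb hs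
      · simp only [Prog.time]; omega
    · obtain ⟨s, hs, hs'⟩ := loopless_runs q m h.2
      refine ⟨b.cost + s + 1, ?_, ?_⟩
      · simp only [Prog.exec, if_neg hb]; exact .ite_false p hb hs
      · simp only [Prog.time]; omega
  | .while _ _, _, h => by simp [Prog.loopless] at h

theorem of_loopless (hp : p.loopless = true) (hT : p.time ≤ T) (hQ : Q (p.exec m)) :
    HT p m T Q := by
  obtain ⟨t, ht, ht'⟩ := loopless_runs p m hp
  exact ⟨_, t, ht, ht'.trans hT, hQ⟩

/-- The rule for bounded loops. `I i` is the invariant before pass `i`; it is asserted after the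
counter has been set. -/
theorem forLoop {r b : ℕ} (n T : ℕ) (I : ℕ → Mem → Prop) (hr : r ∉ p.wr) (hb : b ∉ p.wr)
    (hrb : b ≠ r) (hn : m.reg b = n) (h₀ : I 0 (m.setReg r 0))
    (hs : ∀ i < n, ∀ m₁, Frame (.forLoop r b p) m m₁ → m₁.reg r = i → m₁.reg b = n → I i m₁ →
      HT p m₁ T (fun m₂ => I (i + 1) (m₂.setReg r (i + 1)))) :
    HT (.forLoop r b p) m (n * (T + 9) + 7) (I n) := by
  -- Induction on the number `j` of passes that are left.
  have key : ∀ j i, i + j = n → ∀ m₁, Frame (.forLoop r b p) m m₁ → m₁.reg r = i →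
      m₁.reg b = n → I i m₁ →
      HT (.while (.lt (.reg r) (.reg b)) (.seq p (.set r (.reg r + 1)))) m₁
        (j * (T + 9) + 4) (I n) := by
    intro j
    induction j with
    | zero =>
      intro i hi m₁ _ h₁ h₂ h₃
      refine ⟨m₁, _, .while_false _ ?_, ?_, ?_⟩
      · simp only [Test.Holds, Expr.eval_reg, h₁, h₂, not_lt]
        exact_mod_cast (by omega : n ≤ i)
      · simp [Test.cost, Expr.cost]
      · rwa [← hi, add_zero]
    | succ j ih =>
      intro i hi m₁ hf h₁ h₂ h₃
      obtain ⟨m₂, t, hrun, ht, hI⟩ := hs i (by omega) m₁ hf h₁ h₂ h₃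
      have hr' : m₂.reg r = i := by rw [hrun.frame.reg r hr, h₁]
      have hrun' := Runs.set m₂ r (.reg r + 1)
      simp only [Expr.eval_add, Expr.eval_reg, Expr.eval_one, hr'] at hrun'
      have hrun₂ := Runs.seq hrun hrun'
      obtain ⟨m₃, t₃, hrun₃, ht₃, hI₃⟩ := ih (i + 1) (by omega) (m₂.setReg r (i + 1))
        ⟨fun r' h' => by
          simp only [Prog.forLoop, Prog.wr, List.mem_append, List.mem_singleton, not_or] at h'
          rw [Mem.reg_setReg, if_neg h'.1, hrun.frame.reg r' h'.2.1,
            hf.reg r' (by simp [Prog.forLoop, Prog.wr, h'.1, h'.2.1])],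
         fun a h' => by
          simp only [Prog.forLoop, Prog.wa, List.nil_append, List.append_nil] at h'
          rw [Mem.arr_setReg, hrun.frame.arr a h',
            hf.arr a (by simp [Prog.forLoop, Prog.wa, h'])]⟩
        (by simp [Mem.reg_setReg])
        (by rw [Mem.reg_setReg, if_neg hrb, hrun.frame.reg b hb, h₂]) hI
      refine ⟨m₃, _, .while_true ?_ hrun₂ hrun₃, ?_, hI₃⟩
      · simp only [Test.Holds, Expr.eval_reg, h₁, h₂]
        exact_mod_cast (by omega : i < n)
      · have : (Expr.reg r + 1).cost = 3 := rfl
        simp only [Test.cost, Expr.cost]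
        have : (j + 1) * (T + 9) = j * (T + 9) + (T + 9) := by ring
        omega
  have h0 : (Expr.eval m 0) = 0 := Expr.eval_zero m
  have hset := Runs.set m r 0
  rw [h0] at hset
  obtain ⟨m', t, h, ht, hI⟩ := key n 0 (by omega) (m.setReg r 0)
    ⟨fun r' h' => by
      simp only [Prog.forLoop, Prog.wr, List.mem_append, List.mem_singleton, not_or] at h'
      rw [Mem.reg_setReg, if_neg h'.1], fun a _ => rfl⟩
    (by simp [Mem.reg_setReg]) (by rw [Mem.reg_setReg, if_neg hrb, hn]) h₀
  refine ⟨m', _, .seq hset h, ?_, hI⟩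
  have : (0 : Expr).cost = 1 := rfl
  omega

end HT

end RealRAM

/-! ### Digits, codes of lists, and increasing selections -/

namespace PixelTower

/-- Every sequence of `d` digits below `K` is the base-`K` expansion of a number below `K ^ d`. -/
theorem exists_digits {K d : ℕ} (f : ℕ → ℕ) (hf : ∀ l < d, f l < K) :
    ∃ c < K ^ d, ∀ l < d, c / K ^ l % K = f l := by
  let x := finFunctionFinEquiv (fun l : Fin d => (⟨f l, hf l l.2⟩ : Fin K))
  refine ⟨x, x.2, fun l hl => ?_⟩
  have h := congrFun (finFunctionFinEquiv.symm_apply_apply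
    (fun l : Fin d => (⟨f l, hf l l.2⟩ : Fin K))) ⟨l, hl⟩
  exact congrArg Fin.val h

theorem floor_natCast_div (q K : ℕ) : (⌊(q : ℝ) / K⌋ : ℝ) = ((q / K : ℕ) : ℝ) := by
  rw [← Nat.floor_div_eq_div (K := ℝ) q K, natCast_floor_eq_intCast_floor (by positivity)]

theorem cast_digit (q K : ℕ) : (q : ℝ) - K * ((q / K : ℕ) : ℝ) = ((q % K : ℕ) : ℝ) := by
  have : ((q % K + K * (q / K) : ℕ) : ℝ) = q := by rw [Nat.mod_add_div]
  push_cast at this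
  linarith

theorem floor_address (a b c : ℕ) : ⌊(a : ℝ) * b + c⌋₊ = a * b + c := by
  rw [← Nat.cast_mul, ← Nat.cast_add, Nat.floor_natCast]

/-- One step of the numbering of lists of natural numbers. -/
def codeStep (h c : ℕ) : ℕ := (h + (c + 1)) * (h + (c + 1)) + (c + 1)

/-- An injective numbering of the lists of natural numbers, computed from left to right with a
bounded number of arithmetic operations for each entry. -/
def code (L : List ℕ) : ℕ := L.foldl codeStep 0

/-- Between consecutive squares `a ^ 2` and `(a + 1) ^ 2`, the remainder `c + 1 ≤ a` determines
`c`, and then `a = h + (c + 1)` determines `h`. -/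
theorem codeStep_injective {h c h' c' : ℕ} (e : codeStep h c = codeStep h' c') :
    h = h' ∧ c = c' := by
  unfold codeStep at e
  rcases lt_trichotomy (h + (c + 1)) (h' + (c' + 1)) with hlt | heq | hlt
  · nlinarith
  · rw [heq] at e; omega
  · nlinarith

theorem code_append_singleton (L : List ℕ) (v : ℕ) : code (L ++ [v]) = codeStep (code L) v := by
  simp [code]

/-- No step has the value `0`, which belongs to the empty list, so lists of different lengths are
also told apart. -/
theorem code_injective : Function.Injective code := by
  intro L
  induction L using List.reverseRecOn with
  | nil =>
    intro L' h
    induction L' using List.reverseRecOn with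
    | nil => rfl
    | append_singleton L' v _ =>
      rw [code_append_singleton] at h
      simp [code, codeStep] at h
  | append_singleton L v ih =>
    intro L' h
    induction L' using List.reverseRecOn with
    | nil =>
      rw [code_append_singleton] at h
      simp [code, codeStep] at h
    | append_singleton L' v' _ =>
      rw [code_append_singleton, code_append_singleton] at h
      obtain ⟨h₁, rfl⟩ := codeStep_injective h
      rw [ih h₁]

/-- An injective polynomial numbering of the integers. -/
def intCode (z : ℤ) : ℕ := (z * (2 * z + 1)).toNat

theorem intCode_cast (z : ℤ) : (intCode z : ℤ) = z * (2 * z + 1) := by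
  rw [intCode, Int.toNat_of_nonneg]
  rcases le_or_gt 0 z with h | h <;> nlinarith

theorem intCode_injective : Function.Injective intCode := by
  intro z w h
  have h : (intCode z : ℤ) = intCode w := by rw [h]
  rw [intCode_cast, intCode_cast] at h
  have : (z - w) * (2 * (z + w) + 1) = 0 := by ring_nf; linarith
  rcases mul_eq_zero.1 this with h | h <;> omega

/-- The number of the vector of the first `d` values of `z`. -/
def key (d : ℕ) (z : ℕ → ℤ) : ℕ := code ((List.range d).map fun l => intCode (z l))

@[simp] theorem key_zero (z : ℕ → ℤ) : key 0 z = 0 := rfl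

theorem key_succ (d : ℕ) (z : ℕ → ℤ) : key (d + 1) z = codeStep (key d z) (intCode (z d)) := by
  simp [key, List.range_succ, code_append_singleton]

theorem key_congr {d : ℕ} {z w : ℕ → ℤ} (h : ∀ l < d, z l = w l) : key d z = key d w := by
  unfold key
  congr 1
  exact List.map_congr_left fun l hl => by rw [h l (List.mem_range.1 hl)]

theorem eq_of_key_eq {d : ℕ} {z w : ℕ → ℤ} (h : key d z = key d w) : ∀ l < d, z l = w l := by
  intro l hl
  have h₁ := List.map_inj_left.1 (code_injective h) l (List.mem_range.2 hl)
  exact intCode_injective h₁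

/-- A lattice vector as a function on the natural numbers, extended by zero. -/
def coord {d : ℕ} (z : Fin d → ℤ) (l : ℕ) : ℤ := if h : l < d then z ⟨l, h⟩ else 0

theorem coord_val {d : ℕ} (z : Fin d → ℤ) (l : Fin d) : coord z l = z l := by simp [coord]

theorem coord_of_lt {d l : ℕ} (f : ℕ → ℤ) (h : l < d) :
    coord (fun i : Fin d => f i) l = f l := by simp [coord, h]

/-- The number of a lattice vector. -/
def vkey {d : ℕ} (z : Fin d → ℤ) : ℕ := key d (coord z)

theorem vkey_injective {d : ℕ} : Function.Injective (vkey (d := d)) := by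
  intro z w h
  ext l
  have := eq_of_key_eq h l l.2
  rwa [coord_val, coord_val] at this

theorem key_eq_vkey {d : ℕ} (f : ℕ → ℤ) : key d f = vkey (fun l : Fin d => f l) :=
  key_congr fun _ h => (coord_of_lt f h).symm

/-- Read `f 0, f 1, …, f (t - 1)` and keep each value that exceeds all values kept before (and
`0`); the result lists the predecessors of the kept values, and the last kept value. -/
def sel (f : ℕ → ℕ) : ℕ → List ℕ × ℕ
  | 0 => ([], 0)
  | t + 1 => if (sel f t).2 < f t then ((sel f t).1 ++ [f t - 1], f t) else sel f t

theorem sel_spec (f : ℕ → ℕ) (t : ℕ) :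
    (sel f t).1.Pairwise (· < ·) ∧ (sel f t).1.length ≤ t ∧
      (∀ u ∈ (sel f t).1, u < (sel f t).2) ∧ ∀ u ∈ (sel f t).1, ∃ i < t, f i = u + 1 := by
  induction t with
  | zero => simp [sel]
  | succ t ih =>
    obtain ⟨h₁, h₂, h₃, h₄⟩ := ih
    rw [sel]
    split_ifs with h
    · refine ⟨?_, by simpa using h₂, ?_, ?_⟩
      · rw [List.pairwise_append]
        refine ⟨h₁, by simp, fun a ha b hb => ?_⟩
        rw [List.mem_singleton] at hb
        have := h₃ a ha
        omega
      · intro u hu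
        rcases List.mem_append.1 hu with hu | hu
        · exact (h₃ u hu).trans h
        · rw [List.mem_singleton] at hu; dsimp only; omega
      · intro u hu
        rcases List.mem_append.1 hu with hu | hu
        · obtain ⟨i, hi, hi'⟩ := h₄ u hu
          exact ⟨i, by omega, hi'⟩
        · rw [List.mem_singleton] at hu
          exact ⟨t, by omega, by omega⟩
    · refine ⟨h₁, by omega, h₃, fun u hu => ?_⟩
      obtain ⟨i, hi, hi'⟩ := h₄ u hu
      exact ⟨i, by omega, hi'⟩

/-- Every increasing list is selected from its own entries, repeated at the end as often as
needed. -/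
theorem sel_eq {s : List ℕ} (hs : s.Pairwise (· < ·)) (hne : s ≠ []) {f : ℕ → ℕ} {t : ℕ}
    (ht : s.length ≤ t)
    (hf : ∀ i, f i = s[min i (s.length - 1)]'(by
      have := List.length_pos_of_ne_nil hne; omega) + 1) :
    (sel f t).1 = s := by
  have hpos := List.length_pos_of_ne_nil hne
  have hf' : ∀ i (hi : i < s.length), f i = s[i] + 1 := by
    intro i hi
    rw [hf]
    have : min i (s.length - 1) = i := by omega
    simp only [this]
  -- The first `s.length` entries are all kept, and the repetitions after them are all dropped.
  have key : ∀ i ≤ s.length, sel f i = (s.take i, if i = 0 then 0 else f (i - 1)) := by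
    intro i
    induction i with
    | zero => simp [sel]
    | succ i ih =>
      intro hi
      rw [sel, ih (by omega)]
      have hlt : (if i = 0 then 0 else f (i - 1)) < f i := by
        split_ifs with h
        · rw [hf' i (by omega)]; omega
        · rw [hf' i (by omega), hf' (i - 1) (by omega)]
          have := List.pairwise_iff_getElem.1 hs (i - 1) i (by omega) (by omega) (by omega)
          omega
      rw [if_pos hlt]
      simp only [Nat.add_eq_zero_iff, one_ne_zero, and_false, if_false, Nat.add_sub_cancel,
        Prod.mk.injEq, and_true]
      rw [List.take_add_one, List.getElem?_eq_getElem (by omega), hf' i (by omega)]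
      simp
  have key₂ : ∀ j, sel f (s.length + j) = (s, f (s.length - 1)) := by
    intro j
    induction j with
    | zero => rw [add_zero, key _ le_rfl]; simp [hpos.ne']
    | succ j ih =>
      rw [← add_assoc, sel, ih, if_neg]
      rw [hf, hf]
      have : min (s.length + j) (s.length - 1) = min (s.length - 1) (s.length - 1) := by omega
      simp only [this, lt_irrefl, not_false_eq_true]
  obtain ⟨j, rfl⟩ := Nat.exists_eq_add_of_le ht
  rw [key₂]

end PixelTower

/-! ### Pixels, their intersections, and the map to the next grid -/

namespace PixelTower

theorem gridScale_pos (α : ℝ) : 0 < gridScale α := by unfold gridScale; positivity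

theorem side_pos {d : ℕ} {ε : ℝ} (α : ℝ) (hd : 1 ≤ d) (hε : 0 < ε) : 0 < side d ε α := by
  have := gridScale_pos α
  have : (0 : ℝ) < d := by exact_mod_cast hd
  unfold side
  positivity

theorem scales_pos {ε α : ℝ} (hε : 0 < ε) (hα : α ∈ scales ε) : 0 < α := by
  obtain ⟨i, rfl⟩ := hα
  positivity

theorem gridScale_le {α : ℝ} (hα : 0 < α) : gridScale α ≤ α := (isGreatest_gridScale hα).1.2

theorem lt_two_mul_gridScale (α : ℝ) : α < 2 * gridScale α := by
  have h := Int.lt_zpow_succ_log_self (R := ℝ) (b := 2) one_lt_two α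
  rw [zpow_add₀ (by norm_num)] at h
  unfold gridScale
  push_cast at h
  linarith

theorem gridScale_eq_exp {α : ℝ} (hα : 0 < α) :
    gridScale α = Real.exp (Real.log 2 * ⌊Real.log α / Real.log 2⌋) := by
  have h := Real.floor_logb_natCast (b := 2) hα.le
  unfold gridScale
  rw [← h, Real.logb, mul_comm, ← Real.rpow_intCast, Real.rpow_def_of_pos (by norm_num), mul_comm]
  norm_num

/-- The ratio of the grid scale at `α` to the grid scale at `(1 + ε) α`. -/
noncomputable def ratio (ε α : ℝ) : ℝ := gridScale α / gridScale ((1 + ε) * α)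

/-- The factor `1 + ε` is less than `2`, so it raises the exponent of the grid scale by at most
one. -/
theorem ratio_eq {ε α : ℝ} (hε : 0 < ε) (hε' : ε ≤ 1 / 5) (hα : 0 < α) :
    ratio ε α = 1 ∨ ratio ε α = 1 / 2 := by
  have hα' : α ≤ (1 + ε) * α := by nlinarith
  have h₁ : Int.log 2 α ≤ Int.log 2 ((1 + ε) * α) := Int.log_mono_right hα hα'
  have h₂ : Int.log 2 ((1 + ε) * α) < Int.log 2 α + 2 := by
    rw [← Int.lt_zpow_iff_log_lt (b := 2) one_lt_two (by positivity)]
    have := lt_two_mul_gridScale α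
    have hp := gridScale_pos α
    unfold gridScale at this hp
    push_cast
    rw [zpow_add₀ (by norm_num)]
    norm_num
    nlinarith
  unfold ratio gridScale
  rw [← zpow_sub₀ (by norm_num)]
  rcases (by omega : Int.log 2 α - Int.log 2 ((1 + ε) * α) = 0 ∨
    Int.log 2 α - Int.log 2 ((1 + ε) * α) = -1) with h | h
  · left; rw [h]; simp
  · right; rw [h]; norm_num

theorem side_eq_ratio_mul (d : ℕ) (ε α : ℝ) :
    side d ε α = ratio ε α * side d ε ((1 + ε) * α) := by
  have := (gridScale_pos ((1 + ε) * α)).ne'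
  unfold side ratio
  field_simp

/-- The lattice vector, in the next grid, of the pixel that contains `pixel s z`. -/
noncomputable def nextVec {d : ℕ} (ε α : ℝ) (z : Fin d → ℤ) : Fin d → ℤ :=
  fun l => ⌊(z l : ℝ) * ratio ε α⌋

/-- In units of the next side, the interval of the pixel lies in the interval of its image. -/
theorem nextVec_bounds {d : ℕ} {ε α : ℝ} (hε : 0 < ε) (hε' : ε ≤ 1 / 5) (hα : 0 < α)
    (z : Fin d → ℤ) (l : Fin d) :
    (nextVec ε α z l : ℝ) ≤ z l * ratio ε α ∧
      z l * ratio ε α + ratio ε α ≤ nextVec ε α z l + 1 := by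
  refine ⟨Int.floor_le _, ?_⟩
  have hlt := Int.lt_floor_add_one ((z l : ℝ) * ratio ε α)
  unfold nextVec
  rcases ratio_eq hε hε' hα with h | h
  · rw [h]; simp
  · rw [h] at hlt ⊢
    have : (z l : ℝ) < 2 * (⌊(z l : ℝ) * (1 / 2)⌋ : ℝ) + 2 := by linarith
    have : z l < 2 * ⌊(z l : ℝ) * (1 / 2)⌋ + 2 := by exact_mod_cast this
    have : z l + 1 ≤ 2 * ⌊(z l : ℝ) * (1 / 2)⌋ + 2 := by omega
    have : (z l : ℝ) + 1 ≤ 2 * (⌊(z l : ℝ) * (1 / 2)⌋ : ℝ) + 2 := by exact_mod_cast this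
    linarith

theorem center_mem_pixel {d : ℕ} {s : ℝ} (hs : 0 < s) (z : Fin d → ℤ) :
    center s z ∈ pixel s z := by
  intro l
  change s * z l ≤ s * (z l + 1 / 2) ∧ s * (z l + 1 / 2) ≤ s * (z l + 1)
  constructor <;> nlinarith

theorem pixel_injective {d : ℕ} {s : ℝ} (hs : 0 < s) :
    Function.Injective (pixel (d := d) s) := by
  intro z w h
  have hc := center_mem_pixel hs z
  rw [h] at hc
  ext l
  obtain ⟨h₁, h₂⟩ : s * w l ≤ s * (z l + 1 / 2) ∧ s * (z l + 1 / 2) ≤ s * (w l + 1) := hc l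
  have h₁ := le_of_mul_le_mul_left h₁ hs
  have h₂ := le_of_mul_le_mul_left h₂ hs
  have h₃ : (w l : ℝ) < z l + 1 := by linarith
  have h₄ : (z l : ℝ) < w l + 1 := by linarith
  have h₃ : w l < z l + 1 := by exact_mod_cast h₃
  have h₄ : z l < w l + 1 := by exact_mod_cast h₄
  omega

/-- The lattice point `s w` lies in each pixel `pixel s z` with `w - z ∈ {0, 1} ^ d`. -/
theorem mem_pixel_of_corner {d : ℕ} {s : ℝ} (hs : 0 < s) {z w : Fin d → ℤ}
    (h : ∀ l, w l - 1 ≤ z l ∧ z l ≤ w l) :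
    (WithLp.toLp 2 fun l => s * (w l : ℝ) : EuclideanSpace ℝ (Fin d)) ∈ pixel s z := by
  intro l
  change s * z l ≤ s * w l ∧ s * w l ≤ s * (z l + 1)
  have h₁ : (w l : ℝ) ≤ z l + 1 := by exact_mod_cast (by have := (h l).1; omega : w l ≤ z l + 1)
  have h₂ : (z l : ℝ) ≤ w l := by exact_mod_cast (h l).2
  exact ⟨mul_le_mul_of_nonneg_left h₂ hs.le, mul_le_mul_of_nonneg_left h₁ hs.le⟩

/-- Pixels with a common point have lattice vectors that differ by at most one along each axis. -/
theorem le_add_one_of_mem_pixel {d : ℕ} {s : ℝ} (hs : 0 < s) {z w : Fin d → ℤ}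
    {x : EuclideanSpace ℝ (Fin d)} (hz : x ∈ pixel s z) (hw : x ∈ pixel s w) (l : Fin d) :
    z l ≤ w l + 1 := by
  have h : (z l : ℝ) ≤ w l + 1 := le_of_mul_le_mul_left ((hz l).1.trans (hw l).2) hs
  exact_mod_cast h

theorem pixel_subset_next {d : ℕ} {ε α : ℝ} (hd : 1 ≤ d) (hε : 0 < ε) (hε' : ε ≤ 1 / 5)
    (hα : 0 < α) (z : Fin d → ℤ) :
    pixel (side d ε α) z ⊆ pixel (side d ε ((1 + ε) * α)) (nextVec ε α z) := by
  intro x hx l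
  obtain ⟨h₁, h₂⟩ := hx l
  obtain ⟨h₃, h₄⟩ := nextVec_bounds hε hε' hα z l
  have hs := side_pos ((1 + ε) * α) hd hε
  rw [side_eq_ratio_mul] at h₁ h₂
  constructor <;> nlinarith

theorem eq_nextVec {d : ℕ} {ε α : ℝ} (hd : 1 ≤ d) (hε : 0 < ε) (hε' : ε ≤ 1 / 5)
    (hα : 0 < α) {z w : Fin d → ℤ}
    (h : pixel (side d ε α) z ⊆ pixel (side d ε ((1 + ε) * α)) w) : w = nextVec ε α z := by
  have hs := side_pos ((1 + ε) * α) hd hε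
  have hc := h (center_mem_pixel (side_pos α hd hε) z)
  ext l
  obtain ⟨h₁, h₂⟩ : side d ε ((1 + ε) * α) * w l ≤ side d ε α * (z l + 1 / 2) ∧
    side d ε α * (z l + 1 / 2) ≤ side d ε ((1 + ε) * α) * (w l + 1) := hc l
  rw [side_eq_ratio_mul d ε α, mul_comm (ratio ε α), mul_assoc] at h₁ h₂
  have h₁ := le_of_mul_le_mul_left h₁ hs
  have h₂ := le_of_mul_le_mul_left h₂ hs
  obtain ⟨h₃, h₄⟩ := nextVec_bounds hε hε' hα z l
  have hr : 0 < ratio ε α := by rcases ratio_eq hε hε' hα with h | h <;> rw [h] <;> norm_num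
  have h₅ : (w l : ℝ) < nextVec ε α z l + 1 := by nlinarith
  have h₆ : (nextVec ε α z l : ℝ) < w l + 1 := by nlinarith
  have h₅ : w l < nextVec ε α z l + 1 := by exact_mod_cast h₅
  have h₆ : nextVec ε α z l < w l + 1 := by exact_mod_cast h₆
  omega

/-- The two centers differ by at most half a side along each axis, hence by at most
`√d s / 2 = ε β / 8`, where `β` is the grid scale. -/
theorem dist_center_next {d : ℕ} {ε α : ℝ} (hd : 1 ≤ d) (hε : 0 < ε) (hε' : ε ≤ 1 / 5)
    (hα : 0 < α) (z : Fin d → ℤ) :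
    dist (center (side d ε ((1 + ε) * α)) (nextVec ε α z)) (center (side d ε α) z) ≤ ε * α := by
  have hs := side_pos ((1 + ε) * α) hd hε
  have hs' := side_pos α hd hε
  have hr : 1 / 2 ≤ ratio ε α := by rcases ratio_eq hε hε' hα with h | h <;> rw [h] <;> norm_num
  rw [EuclideanSpace.dist_eq]
  have hle : ∀ l : Fin d, dist (center (side d ε ((1 + ε) * α)) (nextVec ε α z) l)
      (center (side d ε α) z l) ^ 2 ≤ (side d ε α / 2) ^ 2 := by
    intro l
    obtain ⟨h₃, h₄⟩ := nextVec_bounds hε hε' hα z l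
    refine pow_le_pow_left₀ dist_nonneg ?_ 2
    change |side d ε ((1 + ε) * α) * (nextVec ε α z l + 1 / 2) -
      side d ε α * (z l + 1 / 2)| ≤ _
    rw [side_eq_ratio_mul d ε α]
    have e : side d ε ((1 + ε) * α) * (nextVec ε α z l + 1 / 2) -
        ratio ε α * side d ε ((1 + ε) * α) * (z l + 1 / 2) = side d ε ((1 + ε) * α) *
        (nextVec ε α z l + 1 / 2 - ratio ε α * (z l + 1 / 2)) := by ring
    have e' : ratio ε α * side d ε ((1 + ε) * α) / 2 =
        side d ε ((1 + ε) * α) * (ratio ε α / 2) := by ring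
    rw [e, e', abs_mul, abs_of_pos hs]
    refine mul_le_mul_of_nonneg_left (abs_le.2 ⟨?_, ?_⟩) hs.le <;> linarith
  have hd' : (0 : ℝ) < d := by exact_mod_cast hd
  have hβ := gridScale_le hα
  calc √(∑ l, dist (center (side d ε ((1 + ε) * α)) (nextVec ε α z) l)
          (center (side d ε α) z l) ^ 2)
      ≤ √(∑ _l : Fin d, (side d ε α / 2) ^ 2) :=
        Real.sqrt_le_sqrt (Finset.sum_le_sum fun l _ => hle l)
    _ = √d * (side d ε α / 2) := by
        rw [Finset.sum_const, Finset.card_univ, Fintype.card_fin, nsmul_eq_mul,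
          Real.sqrt_mul hd'.le, Real.sqrt_sq (by positivity)]
    _ = ε * gridScale α / 8 := by
        unfold side
        have := (Real.sqrt_pos.2 hd').ne'
        field_simp
        ring
    _ ≤ ε * α := by
        have := gridScale_pos α
        nlinarith

theorem nextVec_mem {d n : ℕ} {ε α : ℝ} (hd : 1 ≤ d) (hε : 0 < ε) (hε' : ε ≤ 1 / 5)
    (hα : 0 < α) {P : Fin n → EuclideanSpace ℝ (Fin d)} {z : Fin d → ℤ}
    (h : ∃ a : Fin n, dist (center (side d ε α) z) (P a) ≤ α) :
    pixel (side d ε ((1 + ε) * α)) (nextVec ε α z) ∈ pixels ε P ((1 + ε) * α) := by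
  obtain ⟨a, ha⟩ := h
  refine ⟨_, rfl, a, (dist_triangle _ (center (side d ε α) z) _).trans ?_⟩
  have := dist_center_next hd hε hε' hα z
  linarith

/-- The connecting map exists, and it sends `pixel s z` to the pixel of `nextVec ε α z`. -/
theorem exists_connectingMap {d n : ℕ} {ε α : ℝ} (hd : 1 ≤ d) (hε : 0 < ε) (hε' : ε ≤ 1 / 5)
    (hα : 0 < α) (P : Fin n → EuclideanSpace ℝ (Fin d)) :
    ∃ g, IsConnectingMap ε P α g ∧ ∀ z : Fin d → ℤ,
      g (pixel (side d ε α) z) = pixel (side d ε ((1 + ε) * α)) (nextVec ε α z) := by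
  classical
  have hs := side_pos α hd hε
  let g : Set (EuclideanSpace ℝ (Fin d)) → Set (EuclideanSpace ℝ (Fin d)) := fun C =>
    pixel (side d ε ((1 + ε) * α)) (nextVec ε α (Function.invFun (pixel (side d ε α)) C))
  have hg : ∀ z : Fin d → ℤ,
      g (pixel (side d ε α) z) = pixel (side d ε ((1 + ε) * α)) (nextVec ε α z) := by
    intro z
    simp only [g]
    rw [Function.leftInverse_invFun (pixel_injective hs)]
  have hmem : ∀ C ∈ pixels ε P α, g C ∈ pixels ε P ((1 + ε) * α) := by
    rintro C ⟨z, rfl, h⟩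
    rw [hg]
    exact nextVec_mem hd hε hε' hα h
  have hsub : ∀ C ∈ pixels ε P α, C ⊆ g C := by
    rintro C ⟨z, rfl, h⟩
    rw [hg]
    exact pixel_subset_next hd hε hε' hα z
  refine ⟨g, ⟨hmem, hsub, ?_, ?_⟩, hg⟩
  · rintro C ⟨z, rfl, -⟩ C' ⟨w, rfl, -⟩ h
    rw [hg, eq_nextVec hd hε hε' hα h]
  · rintro σ ⟨hne, hS, x, hx⟩
    refine ⟨hne.image g, ?_, x, ?_⟩
    · intro C hC
      simp only [Finset.coe_image, Set.mem_image] at hC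
      obtain ⟨C', hC', rfl⟩ := hC
      exact hmem _ (hS hC')
    · simp only [Finset.mem_image, Set.mem_iInter, forall_exists_index, and_imp]
      rintro _ C hC rfl
      exact hsub C (hS hC) (Set.mem_iInter₂.1 hx C hC)

/-- The number of lattice coordinates, along each axis, that are tried for each point. -/
noncomputable def width (d : ℕ) (ε α : ℝ) : ℕ := ⌊2 * α / side d ε α⌋₊ + 2

/-- The `c`-th lattice vector of the box of side `K` that is tried around the point `p`: its
offsets in the box are the base-`K` digits of `c`. -/
noncomputable def cand (s α : ℝ) (K : ℕ) (p : ℕ → ℝ) (c l : ℕ) : ℤ :=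
  ⌊(p l - α) / s⌋ + ((c / K ^ l % K : ℕ) : ℤ)

theorem dist_center_le_iff {d : ℕ} {s α : ℝ} (hα : 0 < α) (z : Fin d → ℤ)
    (p : EuclideanSpace ℝ (Fin d)) :
    dist (center s z) p ≤ α ↔
      ∑ l : Fin d, (s * (z l + 1 / 2) - p l) * (s * (z l + 1 / 2) - p l) ≤ α * α := by
  rw [EuclideanSpace.dist_eq, Real.sqrt_le_left hα.le, sq]
  have : ∀ l, dist (center s z l) (p l) ^ 2 =
      (s * (z l + 1 / 2) - p l) * (s * (z l + 1 / 2) - p l) := by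
    intro l
    rw [Real.dist_eq, sq_abs, sq]
    rfl
  simp only [this]

/-- Every pixel whose center is close to `p` is tried around `p`. -/
theorem exists_cand {d : ℕ} {ε α : ℝ} (hd : 1 ≤ d) (hε : 0 < ε) {z : Fin d → ℤ}
    {p : EuclideanSpace ℝ (Fin d)} {p' : ℕ → ℝ} (hp : ∀ l : Fin d, p' l = p l)
    (h : dist (center (side d ε α) z) p ≤ α) :
    ∃ c < width d ε α ^ d, ∀ l : Fin d, cand (side d ε α) α (width d ε α) p' c l = z l := by
  have hs := side_pos α hd hε
  have hcoord : ∀ l : Fin d, ⌊(p l - α) / side d ε α⌋ ≤ z l ∧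
      z l < ⌊(p l - α) / side d ε α⌋ + width d ε α := by
    intro l
    have hl : |side d ε α * (z l + 1 / 2) - p l| ≤ α := by
      refine le_trans ?_ h
      have := PiLp.dist_apply_le (center (side d ε α) z) p l
      rwa [Real.dist_eq] at this
    obtain ⟨h₁, h₂⟩ := abs_le.1 hl
    have h₃ : (p l - α) / side d ε α ≤ z l + 1 / 2 := by
      rw [div_le_iff₀ hs]; linarith
    have h₄ : (z l : ℝ) + 1 / 2 ≤ (p l - α) / side d ε α + 2 * α / side d ε α := by
      rw [← add_div, le_div_iff₀ hs]; linarith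
    have h₅ := Int.floor_le ((p l - α) / side d ε α)
    have h₆ := Int.lt_floor_add_one ((p l - α) / side d ε α)
    have h₇ := Nat.lt_floor_add_one (2 * α / side d ε α)
    constructor
    · have : (⌊(p l - α) / side d ε α⌋ : ℝ) < z l + 1 := by linarith
      have : ⌊(p l - α) / side d ε α⌋ < z l + 1 := by exact_mod_cast this
      omega
    · have : (z l : ℝ) < ⌊(p l - α) / side d ε α⌋ + width d ε α := by
        unfold width; push_cast; linarith
      exact_mod_cast this
  obtain ⟨c, hc, hc'⟩ := exists_digits (K := width d ε α) (d := d)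
    (fun l => (coord z l - ⌊(p' l - α) / side d ε α⌋).toNat) (by
      intro l hl
      have := hcoord ⟨l, hl⟩
      have e := coord_val z ⟨l, hl⟩
      have e' := hp ⟨l, hl⟩
      simp only at e e'
      rw [e, e']
      omega)
  refine ⟨c, hc, fun l => ?_⟩
  have := hcoord l
  rw [cand, hc' l l.2, coord_val, hp]
  omega

end PixelTower

/-! ### Listing the pixels -/

-- Registers of the input and of the constants: dimension, number of points, dimension of the
-- skeleton, `ε`, `α`, side of the pixels, ratio of the two sides, width of the box of candidates,
-- number of candidates, `2 ^ d`, number of tuples, and width of a row of the simplex list.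
notation "rDim" => (0 : ℕ)
notation "rNum" => (1 : ℕ)
notation "rSkel" => (2 : ℕ)
notation "rEps" => (3 : ℕ)
notation "rAlpha" => (4 : ℕ)
notation "rSide" => (5 : ℕ)
notation "rRatio" => (6 : ℕ)
notation "rWidth" => (7 : ℕ)
notation "rBox" => (8 : ℕ)
notation "rCube" => (9 : ℕ)
notation "rTuples" => (10 : ℕ)
notation "rRow" => (11 : ℕ)
-- Registers of the first phase: number of listed pixels, loop counters for points, candidates and
-- coordinates, the digits still to be read, their update, the current coordinate, the square of the
-- distance, and the number of the current vector or list.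
notation "rPix" => (12 : ℕ)
notation "rI" => (13 : ℕ)
notation "rC" => (14 : ℕ)
notation "rL" => (15 : ℕ)
notation "rQ" => (16 : ℕ)
notation "rNew" => (17 : ℕ)
notation "rZ" => (18 : ℕ)
notation "rDist" => (19 : ℕ)
notation "rHash" => (20 : ℕ)
-- Arrays: points, listed pixels, sizes and vertices of the listed simplices, images of the listed
-- pixels, and the table of the listed pixels.
notation "aPts" => (0 : ℕ)
notation "aPix" => (1 : ℕ)
notation "aCard" => (2 : ℕ)
notation "aSimp" => (3 : ℕ)
notation "aImg" => (4 : ℕ)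
notation "aPixTab" => (5 : ℕ)

infixr:60 " ;; " => RealRAM.Prog.seq

namespace PixelTower

open RealRAM

/-- The constants of the computation, as kept in memory: `p i` holds the coordinates of the
`i`-th point, `s` is the side of the pixels, `ρ` the ratio to the next side, and `K` the number
of lattice coordinates tried along each axis. -/
structure Env (d n k : ℕ) (s α ρ : ℝ) (K : ℕ) (p : ℕ → ℕ → ℝ) (m : Mem) : Prop where
  dim : m.reg rDim = d
  num : m.reg rNum = n
  alpha : m.reg rAlpha = α
  side : m.reg rSide = s
  ratio : m.reg rRatio = ρ
  width : m.reg rWidth = K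
  box : m.reg rBox = ((K ^ d : ℕ) : ℝ)
  cube : m.reg rCube = ((2 ^ d : ℕ) : ℝ)
  tuples : m.reg rTuples = (((2 ^ d) ^ (k + 1) : ℕ) : ℝ)
  row : m.reg rRow = ((k + 1 : ℕ) : ℝ)
  pts : ∀ i < n, ∀ l < d, m.arr aPts (i * d + l) = p i l

/-- The constants are in the registers up to `11` and in array `0`; a program that does not write
these preserves them. -/
theorem Env.frame {d n k : ℕ} {s α ρ : ℝ} {K : ℕ} {p : ℕ → ℕ → ℝ} {m m' : Mem} {q : Prog}
    (h : Env d n k s α ρ K p m) (hf : Frame q m m') (hr : ∀ r ∈ q.wr, 11 < r)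
    (ha : ∀ a ∈ q.wa, 0 < a) : Env d n k s α ρ K p m' := by
  have h' : ∀ r ≤ 11, m'.reg r = m.reg r := fun r hr' =>
    hf.reg r fun hm => by have := hr r hm; omega
  constructor
  · rw [h' _ (by norm_num), h.dim]
  · rw [h' _ (by norm_num), h.num]
  · rw [h' _ (by norm_num), h.alpha]
  · rw [h' _ (by norm_num), h.side]
  · rw [h' _ (by norm_num), h.ratio]
  · rw [h' _ (by norm_num), h.width]
  · rw [h' _ (by norm_num), h.box]
  · rw [h' _ (by norm_num), h.cube]
  · rw [h' _ (by norm_num), h.tuples]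
  · rw [h' _ (by norm_num), h.row]
  · rw [hf.arr 0 fun hm => lt_irrefl _ (ha 0 hm)]; exact h.pts

/-- Compute one coordinate of a candidate vector and write it, and that of its image, to the
first unused row. -/
def pixBody : Prog :=
  .set rNew (.floor (.reg rQ / .reg rWidth)) ;;
  .set rZ (.floor ((.cell aPts (.reg rI * .reg rDim + .reg rL) - .reg rAlpha) / .reg rSide) +
    (.reg rQ - .reg rWidth * .reg rNew)) ;;
  .store aPix (.reg rPix * .reg rDim + .reg rL) (.reg rZ) ;;
  .store aImg (.reg rPix * .reg rDim + .reg rL) (.floor (.reg rZ * .reg rRatio)) ;;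
  .set rDist (.reg rDist +
    (.reg rSide * (.reg rZ + 1 / 2) - .cell aPts (.reg rI * .reg rDim + .reg rL)) *
    (.reg rSide * (.reg rZ + 1 / 2) - .cell aPts (.reg rI * .reg rDim + .reg rL))) ;;
  .set rZ (.reg rZ * (2 * .reg rZ + 1) + 1) ;;
  .set rHash ((.reg rHash + .reg rZ) * (.reg rHash + .reg rZ) + .reg rZ) ;;
  .set rQ (.reg rNew)

/-- Compute all coordinates of the candidate with number `rQ` around point `rI`. -/
def pixLoop : Prog := .forLoop rL rDim pixBody

theorem pixBody_time : pixBody.time ≤ 150 := by decide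

theorem cast_codeStep (h : ℕ) (z : ℤ) : ((codeStep h (intCode z) : ℕ) : ℝ) =
    (h + (z * (2 * z + 1) + 1)) * (h + (z * (2 * z + 1) + 1)) + (z * (2 * z + 1) + 1) := by
  have : ((intCode z : ℕ) : ℝ) = z * (2 * z + 1) := by
    have := congrArg (Int.cast (R := ℝ)) (intCode_cast z)
    push_cast at this
    exact this
  unfold codeStep
  push_cast
  rw [this]

theorem pixLoop_spec {d n k : ℕ} {s α ρ : ℝ} {K : ℕ} {p : ℕ → ℕ → ℝ} {m : Mem}
    (he : Env d n k s α ρ K p m) {N i c : ℕ} (hN : m.reg rPix = N) (hi : m.reg rI = i)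
    (hin : i < n) (hq : m.reg rQ = c) (hdist : m.reg rDist = 0) (hhash : m.reg rHash = 0) :
    HT pixLoop m (d * 159 + 7) fun m' =>
      m'.reg rHash = key d (cand s α K (p i) c) ∧
      m'.reg rDist = ∑ l ∈ Finset.range d, (s * (cand s α K (p i) c l + 1 / 2) - p i l) *
        (s * (cand s α K (p i) c l + 1 / 2) - p i l) ∧
      (∀ l < d, m'.arr aPix (N * d + l) = cand s α K (p i) c l ∧
        m'.arr aImg (N * d + l) = ⌊(cand s α K (p i) c l : ℝ) * ρ⌋) ∧
      ∀ j < N * d, m'.arr aPix j = m.arr aPix j ∧ m'.arr aImg j = m.arr aImg j := by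
  set z := cand s α K (p i) c with hz
  refine (HT.forLoop (p := pixBody) d 150
    (fun t m' => m'.reg rQ = ((c / K ^ t : ℕ) : ℝ) ∧ m'.reg rHash = key t z ∧
      m'.reg rDist = ∑ l ∈ Finset.range t, (s * (z l + 1 / 2) - p i l) *
        (s * (z l + 1 / 2) - p i l) ∧
      (∀ l < t, m'.arr aPix (N * d + l) = z l ∧
        m'.arr aImg (N * d + l) = ⌊(z l : ℝ) * ρ⌋) ∧
      ∀ j < N * d, m'.arr aPix j = m.arr aPix j ∧ m'.arr aImg j = m.arr aImg j)
    (by decide) (by decide) (by decide) he.dim ?_ ?_).mono le_rfl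
    fun m' _ h => ⟨h.2.1, h.2.2.1, h.2.2.2.1, h.2.2.2.2⟩
  · simp [Mem.reg_setReg, Mem.arr_setReg, hq, hdist, hhash]
  · rintro t ht m₁ hf hl - ⟨h₁, h₂, h₃, h₄, h₅⟩
    have he₁ := he.frame hf (by decide) (by decide)
    have hN₁ : m₁.reg rPix = N := by rw [hf.reg _ (by decide), hN]
    have hi₁ : m₁.reg rI = i := by rw [hf.reg _ (by decide), hi]
    have hpt := he₁.pts i hin t ht
    have hzt : ((⌊(p i t - α) / s⌋ : ℤ) : ℝ) + ((c / K ^ t % K : ℕ) : ℝ) = z t := by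
      rw [hz, cand]; push_cast; rfl
    refine HT.of_loopless rfl pixBody_time ?_
    simp only [pixBody, Prog.exec, Expr.eval_add, Expr.eval_sub, Expr.eval_mul, Expr.eval_div,
      Expr.eval_reg, Expr.eval_cell, Expr.eval_floor, Expr.eval_one, Expr.eval_two,
      Mem.reg_setReg, Mem.arr_setReg, Mem.reg_setArr, Mem.arr_setArr, hl, hN₁, hi₁, he₁.dim,
      he₁.side, he₁.alpha, he₁.ratio, he₁.width, h₁, h₂, h₃, floor_address, hpt,
      floor_natCast_div, cast_digit, hzt, Nat.reduceEqDiff, if_true, if_false, true_and,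
      false_and, OfNat.ofNat_ne_one, OfNat.zero_ne_ofNat,
      OfNat.one_ne_ofNat, Nat.cast_inj]
    refine ⟨?_, ?_, ?_, ?_, ?_⟩
    · rw [Nat.div_div_eq_div_mul, pow_succ]
    · rw [key_succ, cast_codeStep]
    · rw [Finset.sum_range_succ]
    · intro l hl'
      rcases Nat.lt_succ_iff_lt_or_eq.1 hl' with h | rfl
      · simp [h.ne, h₄ l h]
      · simp
    · intro j hj
      have : j ≠ N * d + t := by omega
      simp [this, h₅ j hj]

/-- The memory holds the list `L` of lattice vectors, without repetitions, their images in the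
next grid, and a table from the numbers of the vectors to their positions, counted from one;
the table is zero at all other vectors. -/
structure PixRep {d : ℕ} (ε α : ℝ) (L : List (Fin d → ℤ)) (m : Mem) : Prop where
  nodup : L.Nodup
  count : m.reg rPix = L.length
  coord : ∀ (a : ℕ) (h : a < L.length) (l : Fin d), m.arr aPix (a * d + l) = L[a] l
  img : ∀ (a : ℕ) (h : a < L.length) (l : Fin d), m.arr aImg (a * d + l) = nextVec ε α L[a] l
  tab : ∀ (a : ℕ) (h : a < L.length), m.arr aPixTab (vkey L[a]) = ((a + 1 : ℕ) : ℝ)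
  tab_zero : ∀ z, z ∉ L → m.arr aPixTab (vkey z) = 0

theorem PixRep.congr {d : ℕ} {ε α : ℝ} {L : List (Fin d → ℤ)} {m m' : Mem} (h : PixRep ε α L m)
    (hr : m'.reg rPix = m.reg rPix) (h₁ : m'.arr aPix = m.arr aPix)
    (h₂ : m'.arr aImg = m.arr aImg) (h₃ : m'.arr aPixTab = m.arr aPixTab) :
    PixRep ε α L m' where
  nodup := h.nodup
  count := by rw [hr, h.count]
  coord := by rw [h₁]; exact h.coord
  img := by rw [h₂]; exact h.img
  tab := by rw [h₃]; exact h.tab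
  tab_zero := by rw [h₃]; exact h.tab_zero

theorem PixRep.tab_ne_zero_iff {d : ℕ} {ε α : ℝ} {L : List (Fin d → ℤ)} {m : Mem}
    (h : PixRep ε α L m) (z : Fin d → ℤ) : m.arr aPixTab (vkey z) = 0 ↔ z ∉ L := by
  refine ⟨fun h' hz => ?_, h.tab_zero z⟩
  obtain ⟨a, ha, rfl⟩ := List.getElem_of_mem hz
  rw [h.tab a ha] at h'
  norm_cast at h'

/-- Accept the vector in the first unused row if its center is close enough to the point and it
is not listed yet. -/
def pixAccept : Prog :=
  .ite (.le (.reg rDist) (.reg rAlpha * .reg rAlpha))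
    (.ite (.eq (.cell aPixTab (.reg rHash)) 0)
      (.store aPixTab (.reg rHash) (.reg rPix + 1) ;; .set rPix (.reg rPix + 1)) .skip) .skip

/-- Try the candidate with number `rC` around point `rI`. A rejected candidate stays in the first
unused row and is overwritten by the next one. -/
def pixTry : Prog :=
  (.set rQ (.reg rC) ;; .set rDist 0 ;; .set rHash 0) ;; pixLoop ;; pixAccept

/-- List the pixels around all points. -/
def pixProg : Prog := .forLoop rI rNum (.forLoop rC rBox pixTry)

theorem pixAccept_spec {d : ℕ} {ε α D : ℝ} {m : Mem} {L : List (Fin d → ℤ)} {z : Fin d → ℤ}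
    (hα : m.reg rAlpha = α) (hD : m.reg rDist = D) (hh : m.reg rHash = vkey z)
    (hL : PixRep ε α L m) (hz : ∀ l : Fin d, m.arr aPix (L.length * d + l) = z l)
    (hz' : ∀ l : Fin d, m.arr aImg (L.length * d + l) = nextVec ε α z l) :
    HT pixAccept m 30 fun m' => ∃ L', PixRep ε α L' m' ∧ L'.length ≤ L.length + 1 ∧
      ∀ w, w ∈ L' ↔ w ∈ L ∨ w = z ∧ D ≤ α * α := by
  refine HT.of_loopless rfl (by decide) ?_
  simp only [pixAccept, Prog.exec, Test.Holds, Expr.eval_mul, Expr.eval_reg, Expr.eval_cell,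
    Expr.eval_zero, Expr.eval_add, Expr.eval_one, hα, hD, hh, Nat.floor_natCast,
    hL.tab_ne_zero_iff, hL.count, Mem.reg_setArr]
  split_ifs with h₁ h₂
  · refine ⟨L, hL, by simp, fun w => ?_⟩
    constructor
    · exact Or.inl
    · rintro (h | ⟨rfl, -⟩)
      exacts [h, h₂]
  · refine ⟨L ++ [z], ?_, by simp, fun w => by simp [h₁]⟩
    have hget : ∀ a (h : a < (L ++ [z]).length), a < L.length ∨ a = L.length := by
      intro a h
      rw [List.length_append, List.length_singleton] at h
      omega
    constructor
    · rw [List.nodup_append]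
      exact ⟨hL.nodup, by simp, fun a ha b hb => by rintro rfl; exact h₂ (List.mem_singleton.1 hb ▸ ha)⟩
    · simp [Mem.reg_setReg]
    · intro a h l
      rcases hget a h with h' | rfl
      · simp [Mem.arr_setReg, Mem.arr_setArr, hL.coord a h' l, List.getElem_append_left h']
      · simp [Mem.arr_setReg, Mem.arr_setArr, hz]
    · intro a h l
      rcases hget a h with h' | rfl
      · simp [Mem.arr_setReg, Mem.arr_setArr, hL.img a h' l, List.getElem_append_left h']
      · simp [Mem.arr_setReg, Mem.arr_setArr, hz']
    · intro a h
      rcases hget a h with h' | rfl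
      · have : L[a] ≠ z := fun h => h₂ (h ▸ List.getElem_mem h')
        simp [Mem.arr_setReg, Mem.arr_setArr, hL.tab a h', List.getElem_append_left h',
          vkey_injective.eq_iff, this]
      · simp [Mem.arr_setReg, Mem.arr_setArr]
    · intro w hw
      simp only [List.mem_append, List.mem_singleton, not_or] at hw
      simp [Mem.arr_setReg, Mem.arr_setArr, vkey_injective.eq_iff, hw.2, hL.tab_zero w hw.1]
  · exact ⟨L, hL, by simp, fun w => by simp [h₁]⟩

theorem pixTry_spec {d n k : ℕ} {s ε α : ℝ} {K : ℕ} {P : Fin n → EuclideanSpace ℝ (Fin d)}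
    {p : ℕ → ℕ → ℝ} (hα : 0 < α) (hp : ∀ (i : Fin n) (l : Fin d), p i l = P i l) {m : Mem}
    (he : Env d n k s α (ratio ε α) K p m) {L : List (Fin d → ℤ)} (hL : PixRep ε α L m) {c : ℕ}
    {i : Fin n} (hi : m.reg rI = (i : ℕ)) (hc : m.reg rC = c) :
    HT pixTry m (d * 159 + 60) fun m' => ∃ L', PixRep ε α L' m' ∧
      L'.length ≤ L.length + 1 ∧ ∀ w, w ∈ L' ↔ w ∈ L ∨
        w = (fun l : Fin d => cand s α K (p i) c l) ∧ dist (center s w) (P i) ≤ α := by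
  refine HT.seq (T₁ := 15) (T₂ := d * 159 + 44) (HT.of_loopless (Q := fun m' =>
    m'.reg rQ = c ∧ m'.reg rDist = 0 ∧ m'.reg rHash = 0 ∧ m'.arr = m.arr)
    rfl (by decide) ?_) (by omega) ?_
  · simp [Prog.exec, Mem.reg_setReg, Mem.arr_setReg, Expr.eval_reg, Expr.eval_zero, hc]
  rintro m₁ hf ⟨h₁, h₂, h₃, h₄⟩
  have he₁ := he.frame hf (by decide) (by decide)
  have hL₁ : PixRep ε α L m₁ := hL.congr (hf.reg _ (by decide)) (by rw [h₄]) (by rw [h₄])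
    (by rw [h₄])
  have hi₁ : m₁.reg rI = (i : ℕ) := by rw [hf.reg _ (by decide), hi]
  refine (pixLoop_spec he₁ hL₁.count hi₁ i.2 h₁ h₂ h₃).seq (T₂ := 30) (by omega) ?_
  rintro m₂ hf₂ ⟨h₅, h₆, h₇, h₈⟩
  have he₂ := he₁.frame hf₂ (by decide) (by decide)
  have hlt : ∀ a (h : a < L.length) (l : Fin d), a * d + l < L.length * d := by
    intro a h l
    calc a * d + l < a * d + d := by have := l.2; omega
      _ = (a + 1) * d := by ring
      _ ≤ L.length * d := Nat.mul_le_mul_right _ h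
  -- Only the first unused row has been written.
  have hL₂ : PixRep ε α L m₂ := by
    refine ⟨hL.nodup, ?_, ?_, ?_, ?_, ?_⟩
    · rw [hf₂.reg _ (by decide), hL₁.count]
    · intro a h l
      rw [(h₈ _ (hlt a h l)).1, hL₁.coord a h l]
    · intro a h l
      rw [(h₈ _ (hlt a h l)).2, hL₁.img a h l]
    · rw [hf₂.arr _ (by decide)]; exact hL₁.tab
    · rw [hf₂.arr _ (by decide)]; exact hL₁.tab_zero
  rw [key_eq_vkey] at h₅
  refine (pixAccept_spec he₂.alpha h₆ h₅ hL₂ (fun l => (h₇ l l.2).1)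
    fun l => (h₇ l l.2).2).mono le_rfl ?_
  rintro m₃ - ⟨L', hL', hlen, hmem⟩
  refine ⟨L', hL', hlen, fun w => ?_⟩
  rw [hmem]
  refine or_congr_right (and_congr_right ?_)
  rintro rfl
  rw [dist_center_le_iff hα, Finset.sum_range]
  simp only [hp]

theorem pixProg_spec {d n k : ℕ} {ε α : ℝ} {P : Fin n → EuclideanSpace ℝ (Fin d)}
    {p : ℕ → ℕ → ℝ} (hd : 1 ≤ d) (hε : 0 < ε) (hα : 0 < α)
    (hp : ∀ (i : Fin n) (l : Fin d), p i l = P i l) {m : Mem}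
    (he : Env d n k (side d ε α) α (ratio ε α) (width d ε α) p m)
    (hL : PixRep (d := d) ε α [] m) :
    HT pixProg m (n * (width d ε α ^ d * (d * 159 + 69) + 16) + 7) fun m' => ∃ L : List (Fin d → ℤ),
      PixRep ε α L m' ∧ L.length ≤ n * width d ε α ^ d ∧
      ∀ w, w ∈ L ↔ ∃ i, dist (center (side d ε α) w) (P i) ≤ α := by
  set s := side d ε α
  set K := width d ε α
  refine (HT.forLoop (p := .forLoop rC rBox pixTry) n (K ^ d * (d * 159 + 69) + 7)
    (fun i m' => ∃ L : List (Fin d → ℤ), PixRep ε α L m' ∧ L.length ≤ i * K ^ d ∧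
      ∀ w, w ∈ L ↔ ∃ j : Fin n, j < i ∧ dist (center s w) (P j) ≤ α)
    (by decide) (by decide) (by decide) he.num ?_ ?_).mono le_rfl ?_
  · exact ⟨[], hL.congr (by simp [Mem.reg_setReg]) rfl rfl rfl, by simp, by simp⟩
  · rintro i hi m₁ hf hri - ⟨L, hL, hlen, hmem⟩
    have he₁ := he.frame hf (by decide) (by decide)
    refine (HT.forLoop (p := pixTry) (K ^ d) (d * 159 + 60)
      (fun c m' => ∃ L' : List (Fin d → ℤ), PixRep ε α L' m' ∧ L'.length ≤ L.length + c ∧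
        ∀ w, w ∈ L' ↔ w ∈ L ∨ (∃ c' < c, w = fun l : Fin d => cand s α K (p i) c' l) ∧
          dist (center s w) (P ⟨i, hi⟩) ≤ α)
      (by decide) (by decide) (by decide) he₁.box ?_ ?_).mono le_rfl ?_
    · exact ⟨L, hL.congr (by simp [Mem.reg_setReg]) rfl rfl rfl, by simp, by simp⟩
    · rintro c hc m₂ hf₂ hrc - ⟨L', hL', hlen', hmem'⟩
      have he₂ := he₁.frame hf₂ (by decide) (by decide)
      refine (pixTry_spec hα hp he₂ hL' (i := ⟨i, hi⟩) (by rw [hf₂.reg _ (by decide), hri])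
        hrc).mono le_rfl ?_
      rintro m₃ - ⟨L₃, hL₃, hlen₃, hmem₃⟩
      refine ⟨L₃, hL₃.congr (by simp [Mem.reg_setReg]) rfl rfl rfl, by omega, fun w => ?_⟩
      rw [hmem₃, hmem', or_assoc, ← or_and_right]
      refine or_congr_right (and_congr_left fun _ => ?_)
      constructor
      · rintro (⟨c', h, rfl⟩ | rfl)
        · exact ⟨c', by omega, rfl⟩
        · exact ⟨c, by omega, rfl⟩
      · rintro ⟨c', h, rfl⟩
        rcases Nat.lt_succ_iff_lt_or_eq.1 h with h | rfl
        · exact Or.inl ⟨c', h, rfl⟩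
        · exact Or.inr rfl
    · rintro m₂ - ⟨L', hL', hlen', hmem'⟩
      refine ⟨L', hL'.congr (by simp [Mem.reg_setReg]) rfl rfl rfl, ?_, fun w => ?_⟩
      · rw [add_one_mul]; omega
      · rw [hmem', hmem]
        constructor
        · rintro (⟨j, hj, h⟩ | ⟨-, h⟩)
          · exact ⟨j, by omega, h⟩
          · exact ⟨⟨i, hi⟩, by simp, h⟩
        · rintro ⟨j, hj, h⟩
          rcases Nat.lt_succ_iff_lt_or_eq.1 hj with hj | rfl
          · exact Or.inl ⟨j, hj, h⟩
          · obtain ⟨c, hc, hc'⟩ := exists_cand hd hε (fun l => hp j l) h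
            exact Or.inr ⟨⟨c, hc, funext fun l => (hc' l).symm⟩, h⟩
  · rintro m' - ⟨L, hL, hlen, hmem⟩
    refine ⟨L, hL, hlen, fun w => ?_⟩
    rw [hmem]
    simp

end PixelTower

/-! ### Listing the simplices -/

-- Registers of the second phase: number of listed simplices, loop counters for pixels, lattice
-- points at a pixel and pixels around a lattice point, the digits of the lattice point still to be
-- read, loop counter for the entries of a tuple, the current entry, the last entry kept, the number
-- of entries kept, and an update. Arrays: the pixels around the current lattice point as positions
-- counted from one (`0` for a pixel that is not listed), and the table of the listed simplices.
notation "rSimp" => (21 : ℕ)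
notation "rA" => (22 : ℕ)
notation "rB" => (23 : ℕ)
notation "rE" => (24 : ℕ)
notation "rP" => (25 : ℕ)
notation "rT" => (26 : ℕ)
notation "rV" => (27 : ℕ)
notation "rPrev" => (28 : ℕ)
notation "rLen" => (29 : ℕ)
notation "rOld" => (30 : ℕ)
notation "aNbr" => (6 : ℕ)
notation "aSimpTab" => (7 : ℕ)

namespace PixelTower

open RealRAM

/-- The lattice point whose offset from `z` is given by the binary digits of `b`. -/
def cornerVec {d : ℕ} (z : Fin d → ℤ) (b : ℕ) : Fin d → ℤ :=
  fun l => z l + ((b / 2 ^ (l : ℕ) % 2 : ℕ) : ℤ)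

/-- The lower corner of the `e`-th of the `2 ^ d` pixels around the lattice point `w`. -/
def aroundVec {d : ℕ} (w : Fin d → ℤ) (e : ℕ) : Fin d → ℤ :=
  fun l => w l - ((e / 2 ^ (l : ℕ) % 2 : ℕ) : ℤ)

/-- The position of `z` in the list, counted from one, or `0` if `z` is not listed. -/
def lookup {d : ℕ} (L : List (Fin d → ℤ)) (z : Fin d → ℤ) : ℕ :=
  if z ∈ L then L.idxOf z + 1 else 0

theorem PixRep.tab_eq {d : ℕ} {ε α : ℝ} {L : List (Fin d → ℤ)} {m : Mem}
    (h : PixRep ε α L m) (z : Fin d → ℤ) : m.arr aPixTab (vkey z) = lookup L z := by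
  unfold lookup
  split_ifs with hz
  · have hlt := List.idxOf_lt_length_of_mem hz
    rw [← h.tab _ hlt, List.getElem_idxOf hlt]
  · rw [h.tab_zero z hz, Nat.cast_zero]

theorem lookup_eq_succ_iff {d : ℕ} {L : List (Fin d → ℤ)} (hL : L.Nodup) {z : Fin d → ℤ}
    {u : ℕ} : lookup L z = u + 1 ↔ ∃ h : u < L.length, L[u] = z := by
  unfold lookup
  constructor
  · intro h
    split_ifs at h with hz
    have hlt := List.idxOf_lt_length_of_mem hz
    obtain rfl : L.idxOf z = u := by omega
    exact ⟨hlt, List.getElem_idxOf hlt⟩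
  · rintro ⟨h, rfl⟩
    rw [if_pos (List.getElem_mem h), hL.idxOf_getElem]

/-- `s` is an increasing list of at most `k + 1` positions of pixels in `L`, all of which
contain the lattice point `w`. -/
def Around {d : ℕ} (L : List (Fin d → ℤ)) (k : ℕ) (w : Fin d → ℤ) (s : List ℕ) : Prop :=
  s ≠ [] ∧ s.Pairwise (· < ·) ∧ s.length ≤ k + 1 ∧
    ∀ u ∈ s, ∃ h : u < L.length, ∀ l, w l - 1 ≤ L[u] l ∧ L[u] l ≤ w l

theorem exists_aroundVec {d : ℕ} {w z : Fin d → ℤ} (h : ∀ l, w l - 1 ≤ z l ∧ z l ≤ w l) :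
    ∃ e < 2 ^ d, z = aroundVec w e := by
  obtain ⟨e, he, he'⟩ := exists_digits (K := 2) (d := d)
    (fun l => (coord w l - coord z l).toNat) (fun l hl => by
      have := h ⟨l, hl⟩
      simp only [coord, hl, dif_pos]
      omega)
  refine ⟨e, he, funext fun l => ?_⟩
  have := h l
  rw [aroundVec, he' l l.2, coord_val, coord_val]
  omega

theorem exists_cornerVec {d : ℕ} {w z : Fin d → ℤ} (h : ∀ l, w l - 1 ≤ z l ∧ z l ≤ w l) :
    ∃ b < 2 ^ d, w = cornerVec z b := by
  obtain ⟨e, he, rfl⟩ := exists_aroundVec h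
  exact ⟨e, he, funext fun l => by simp [cornerVec, aroundVec]⟩

theorem aroundVec_bounds {d : ℕ} (w : Fin d → ℤ) (e : ℕ) (l : Fin d) :
    w l - 1 ≤ aroundVec w e l ∧ aroundVec w e l ≤ w l := by
  have := Nat.mod_lt (e / 2 ^ (l : ℕ)) two_pos
  unfold aroundVec
  omega

theorem sel_congr {f g : ℕ → ℕ} {t : ℕ} (h : ∀ i < t, f i = g i) : sel f t = sel g t := by
  induction t with
  | zero => rfl
  | succ t ih =>
    rw [sel, sel, ih fun i hi => h i (by omega), h t (by omega)]

/-- The sequence of the values of `U` at the base-`D` digits of `c`. -/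
def tuple (U : ℕ → ℕ) (D c t : ℕ) : ℕ := U (c / D ^ t % D)

/-- The selections from all sequences of `k + 1` values of `U` are the increasing lists of at
most `k + 1` predecessors of values of `U`. -/
theorem exists_sel_tuple_iff {U : ℕ → ℕ} {D k : ℕ} (hD : 0 < D) {s : List ℕ} (hne : s ≠ []) :
    (∃ c < D ^ (k + 1), s = (sel (tuple U D c) (k + 1)).1) ↔
      s.Pairwise (· < ·) ∧ s.length ≤ k + 1 ∧ ∀ u ∈ s, ∃ e < D, U e = u + 1 := by
  constructor
  · rintro ⟨c, -, rfl⟩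
    obtain ⟨h₁, h₂, -, h₄⟩ := sel_spec (tuple U D c) (k + 1)
    refine ⟨h₁, h₂, fun u hu => ?_⟩
    obtain ⟨i, -, hi⟩ := h₄ u hu
    exact ⟨_, Nat.mod_lt _ hD, hi⟩
  · rintro ⟨h₁, h₂, h₃⟩
    have hpos := List.length_pos_of_ne_nil hne
    have h : ∀ i : ℕ, ∃ e < D, U e = s[min i (s.length - 1)]'(by omega) + 1 :=
      fun i => h₃ _ (List.getElem_mem _)
    choose e he he' using h
    obtain ⟨c, hc, hc'⟩ := exists_digits (K := D) (d := k + 1) e fun l _ => he l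
    refine ⟨c, hc, ?_⟩
    rw [sel_congr (g := fun i => U (e i)) fun i hi => by rw [tuple, hc' i hi]]
    exact (sel_eq h₁ hne h₂ he').symm

/-- Compute one coordinate of the pixel with number `rE` around the lattice point with number
`rB` at pixel `rA`, and update the number of its vector. -/
def nbrBody : Prog :=
  .set rNew (.floor (.reg rQ / 2)) ;;
  .set rOld (.floor (.reg rP / 2)) ;;
  .set rZ (.cell aPix (.reg rA * .reg rDim + .reg rL) + (.reg rP - 2 * .reg rOld) -
    (.reg rQ - 2 * .reg rNew)) ;;
  .set rZ (.reg rZ * (2 * .reg rZ + 1) + 1) ;;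
  .set rHash ((.reg rHash + .reg rZ) * (.reg rHash + .reg rZ) + .reg rZ) ;;
  .set rQ (.reg rNew) ;;
  .set rP (.reg rOld)

/-- Look up the pixel with number `rE` around the current lattice point. -/
def nbrTry : Prog :=
  (.set rQ (.reg rE) ;; .set rP (.reg rB) ;; .set rHash 0) ;; .forLoop rL rDim nbrBody ;;
  .store aNbr (.reg rE) (.cell aPixTab (.reg rHash))

/-- Look up all pixels around the lattice point with number `rB` at pixel `rA`. -/
def nbrProg : Prog := .forLoop rE rCube nbrTry

theorem nbrTry_spec {d n k : ℕ} {s ε α ρ : ℝ} {K : ℕ} {p : ℕ → ℕ → ℝ} {m : Mem}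
    (he : Env d n k s α ρ K p m) {L : List (Fin d → ℤ)} (hL : PixRep ε α L m) {a b e : ℕ}
    (ha : m.reg rA = a) (hal : a < L.length) (hb : m.reg rB = b) (hre : m.reg rE = e) :
    HT nbrTry m (d * 109 + 40) fun m' =>
      m'.arr aNbr e = lookup L (aroundVec (cornerVec L[a] b) e) ∧
      ∀ j, j ≠ e → m'.arr aNbr j = m.arr aNbr j := by
  refine HT.seq (T₁ := 15) (T₂ := d * 109 + 24) (HT.of_loopless (Q := fun m' =>
    m'.reg rQ = e ∧ m'.reg rP = b ∧ m'.reg rHash = 0 ∧ m'.arr = m.arr)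
    rfl (by decide) ?_) (by omega) ?_
  · simp [Prog.exec, Mem.reg_setReg, Mem.arr_setReg, Expr.eval_reg, Expr.eval_zero, hb, hre]
  rintro m₁ hf ⟨h₁, h₂, h₃, h₄⟩
  have he₁ := he.frame hf (by decide) (by decide)
  have hL₁ : PixRep ε α L m₁ := hL.congr (hf.reg _ (by decide)) (by rw [h₄]) (by rw [h₄])
    (by rw [h₄])
  let z : ℕ → ℤ := fun l => coord L[a] l + ((b / 2 ^ l % 2 : ℕ) : ℤ) - ((e / 2 ^ l % 2 : ℕ) : ℤ)
  refine HT.seq (T₂ := 10) (HT.forLoop (p := nbrBody) d 100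
    (fun t m' => m'.reg rQ = ((e / 2 ^ t : ℕ) : ℝ) ∧ m'.reg rP = ((b / 2 ^ t : ℕ) : ℝ) ∧
      m'.reg rHash = key t z)
    (by decide) (by decide) (by decide) he₁.dim ?_ ?_) (by omega) ?_
  · simp [Mem.reg_setReg, h₁, h₂, h₃]
  · rintro t ht m₂ hf₂ hl - ⟨h₅, h₆, h₇⟩
    have he₂ := he₁.frame hf₂ (by decide) (by decide)
    have ha₂ : m₂.reg rA = a := by rw [hf₂.reg _ (by decide), hf.reg _ (by decide), ha]
    have hpix : m₂.arr aPix (a * d + t) = coord L[a] t := by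
      rw [hf₂.arr _ (by decide), hL₁.coord a hal ⟨t, ht⟩, coord, dif_pos ht]
    have hhalf : ∀ q : ℕ, ((⌊(q : ℝ) / 2⌋ : ℤ) : ℝ) = ((q / 2 : ℕ) : ℝ) := fun q => by
      have := floor_natCast_div q 2
      rwa [Nat.cast_two] at this
    have hdig : ∀ q : ℕ, (q : ℝ) - 2 * ((q / 2 : ℕ) : ℝ) = ((q % 2 : ℕ) : ℝ) := fun q => by
      have := cast_digit q 2
      rwa [Nat.cast_two] at this
    have hz : (coord L[a] t : ℝ) + ((b / 2 ^ t % 2 : ℕ) : ℝ) - ((e / 2 ^ t % 2 : ℕ) : ℝ) =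
        z t := by simp only [z]; push_cast; rfl
    refine HT.of_loopless rfl (by decide) ?_
    simp only [nbrBody, Prog.exec, Expr.eval_add, Expr.eval_sub, Expr.eval_mul, Expr.eval_div,
      Expr.eval_reg, Expr.eval_cell, Expr.eval_floor, Expr.eval_one, Expr.eval_two,
      Mem.reg_setReg, Mem.arr_setReg, hl, ha₂, he₂.dim, h₅, h₆, h₇, floor_address, hpix,
      hhalf, hdig, hz, Nat.reduceEqDiff, if_true, if_false, OfNat.zero_ne_ofNat]
    refine ⟨?_, ?_, ?_⟩
    · rw [Nat.div_div_eq_div_mul, pow_succ]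
    · rw [Nat.div_div_eq_div_mul, pow_succ]
    · rw [key_succ, cast_codeStep]
  · rintro m₂ hf₂ ⟨-, -, h₇⟩
    have hre₂ : m₂.reg rE = e := by rw [hf₂.reg _ (by decide), hf.reg _ (by decide), hre]
    have hzv : key d z = vkey (aroundVec (cornerVec L[a] b) e) := by
      rw [key_eq_vkey]
      congr 1
      ext l
      simp only [z, aroundVec, cornerVec, coord_val]
    have hlook : m₂.arr aPixTab (key d z) = lookup L (aroundVec (cornerVec L[a] b) e) := by
      rw [hf₂.arr _ (by decide), hzv, hL₁.tab_eq]
    refine HT.of_loopless rfl (by decide) ?_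
    simp only [Prog.exec, Expr.eval_reg, Expr.eval_cell, hre₂, h₇, Nat.floor_natCast, hlook,
      Mem.arr_setArr]
    refine ⟨by simp, fun j hj => ?_⟩
    rw [if_neg (by simp [hj]), hf₂.arr _ (by decide), h₄]

theorem nbrProg_spec {d n k : ℕ} {s ε α ρ : ℝ} {K : ℕ} {p : ℕ → ℕ → ℝ} {m : Mem}
    (he : Env d n k s α ρ K p m) {L : List (Fin d → ℤ)} (hL : PixRep ε α L m) {a b : ℕ}
    (ha : m.reg rA = a) (hal : a < L.length) (hb : m.reg rB = b) :
    HT nbrProg m (2 ^ d * (d * 109 + 49) + 7) fun m' =>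
      ∀ e < 2 ^ d, m'.arr aNbr e = lookup L (aroundVec (cornerVec L[a] b) e) := by
  refine HT.forLoop (p := nbrTry) (2 ^ d) (d * 109 + 40) (fun t m' => ∀ e < t, m'.arr aNbr e =
    lookup L (aroundVec (cornerVec L[a] b) e)) (by decide) (by decide) (by decide) he.cube
    (by simp) ?_
  intro t ht m₁ hf hre _ hI
  have he₁ := he.frame hf (by decide) (by decide)
  have hL₁ : PixRep ε α L m₁ := hL.congr (hf.reg _ (by decide)) (hf.arr _ (by decide))
    (hf.arr _ (by decide)) (hf.arr _ (by decide))
  refine (nbrTry_spec he₁ hL₁ (by rw [hf.reg _ (by decide), ha]) hal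
    (by rw [hf.reg _ (by decide), hb]) hre).mono le_rfl ?_
  rintro m₂ - ⟨h₁, h₂⟩ e he
  rw [Mem.arr_setReg]
  rcases Nat.lt_succ_iff_lt_or_eq.1 he with h | rfl
  · rw [h₂ e h.ne, hI e h]
  · exact h₁

/-- The memory holds the list `S` of simplices, without repetitions, in rows of width `k + 1`,
and the table of the numbers of the listed simplices. -/
structure SimpRep (k : ℕ) (S : List (List ℕ)) (m : Mem) : Prop where
  nodup : S.Nodup
  count : m.reg rSimp = S.length
  card : ∀ (b : ℕ) (h : b < S.length), m.arr aCard b = S[b].length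
  len : ∀ s ∈ S, s.length ≤ k + 1
  vertex : ∀ (b : ℕ) (h : b < S.length) (t : ℕ) (ht : t < S[b].length),
    m.arr aSimp (b * (k + 1) + t) = S[b][t]
  tab : ∀ s, m.arr aSimpTab (code s) = if s ∈ S then 1 else 0

theorem SimpRep.congr {k : ℕ} {S : List (List ℕ)} {m m' : Mem} (h : SimpRep k S m)
    (hr : m'.reg rSimp = m.reg rSimp) (h₁ : m'.arr aCard = m.arr aCard)
    (h₂ : m'.arr aSimp = m.arr aSimp) (h₃ : m'.arr aSimpTab = m.arr aSimpTab) :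
    SimpRep k S m' where
  nodup := h.nodup
  count := by rw [hr, h.count]
  card := by rw [h₁]; exact h.card
  len := h.len
  vertex := by rw [h₂]; exact h.vertex
  tab := by rw [h₃]; exact h.tab

/-- Read the next entry of the tuple and append it to the first unused row if it exceeds the
entries before. -/
def tupleBody : Prog :=
  .set rNew (.floor (.reg rQ / .reg rCube)) ;;
  .set rV (.cell aNbr (.reg rQ - .reg rCube * .reg rNew)) ;;
  .set rQ (.reg rNew) ;;
  .ite (.lt (.reg rPrev) (.reg rV))
    (.store aSimp (.reg rSimp * .reg rRow + .reg rLen) (.reg rV - 1) ;;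
      .set rHash ((.reg rHash + .reg rV) * (.reg rHash + .reg rV) + .reg rV) ;;
      .set rPrev (.reg rV) ;;
      .set rLen (.reg rLen + 1))
    .skip

/-- Accept the simplex in the first unused row if it is nonempty and not listed yet. -/
def tupleAccept : Prog :=
  .ite (.lt 0 (.reg rLen))
    (.ite (.eq (.cell aSimpTab (.reg rHash)) 0)
      (.store aSimpTab (.reg rHash) 1 ;; .store aCard (.reg rSimp) (.reg rLen) ;;
        .set rSimp (.reg rSimp + 1)) .skip) .skip

/-- Try the tuple with number `rC`: its entries are at the base-`2 ^ d` digits of `rC`. A rejected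
selection is overwritten by the next one. -/
def tupleTry : Prog :=
  (.set rQ (.reg rC) ;; .set rHash 0 ;; .set rPrev 0 ;; .set rLen 0) ;;
  .forLoop rT rRow tupleBody ;; tupleAccept

/-- List the simplices around the current lattice point. -/
def tupleProg : Prog := .forLoop rC rTuples tupleTry

/-- List the simplices around all lattice points at listed pixels. -/
def simpProg : Prog := .forLoop rA rPix (.forLoop rB rCube (nbrProg ;; tupleProg))

theorem tupleLoop_spec {d n k : ℕ} {s α ρ : ℝ} {K : ℕ} {p : ℕ → ℕ → ℝ} {m : Mem}
    (he : Env d n k s α ρ K p m) {U : ℕ → ℕ} (hU : ∀ e < 2 ^ d, m.arr aNbr e = U e) {M c : ℕ}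
    (hM : m.reg rSimp = M) (hq : m.reg rQ = c) (hh : m.reg rHash = 0) (hp : m.reg rPrev = 0)
    (hlen : m.reg rLen = 0) :
    HT (.forLoop rT rRow tupleBody) m ((k + 1) * 69 + 7) fun m' =>
      m'.reg rHash = code (sel (tuple U (2 ^ d) c) (k + 1)).1 ∧
      m'.reg rLen = (sel (tuple U (2 ^ d) c) (k + 1)).1.length ∧
      (∀ t (h : t < (sel (tuple U (2 ^ d) c) (k + 1)).1.length),
        m'.arr aSimp (M * (k + 1) + t) = (sel (tuple U (2 ^ d) c) (k + 1)).1[t]) ∧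
      ∀ j < M * (k + 1), m'.arr aSimp j = m.arr aSimp j := by
  set f := tuple U (2 ^ d) c with hf'
  refine (HT.forLoop (p := tupleBody) (k + 1) 60
    (fun t m' => m'.reg rQ = ((c / (2 ^ d) ^ t : ℕ) : ℝ) ∧ m'.reg rPrev = (sel f t).2 ∧
      m'.reg rHash = code (sel f t).1 ∧ m'.reg rLen = (sel f t).1.length ∧
      (∀ i (h : i < (sel f t).1.length), m'.arr aSimp (M * (k + 1) + i) = (sel f t).1[i]) ∧
      ∀ j < M * (k + 1), m'.arr aSimp j = m.arr aSimp j)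
    (by decide) (by decide) (by decide) he.row ?_ ?_).mono le_rfl
    fun m' _ h => ⟨h.2.2.1, h.2.2.2.1, h.2.2.2.2.1, h.2.2.2.2.2⟩
  · simp [Mem.reg_setReg, Mem.arr_setReg, hq, hh, hp, hlen, sel, code]
  · rintro t ht m₁ hf - - ⟨h₁, h₂, h₃, h₄, h₅, h₆⟩
    have he₁ := he.frame hf (by decide) (by decide)
    have hM₁ : m₁.reg rSimp = M := by rw [hf.reg _ (by decide), hM]
    have hv : m₁.arr aNbr (c / (2 ^ d) ^ t % 2 ^ d) = f t := by
      rw [hf.arr _ (by decide), hU _ (Nat.mod_lt _ (by positivity))]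
      rfl
    refine HT.of_loopless rfl (by decide) ?_
    simp only [tupleBody, Prog.exec, Test.Holds, Expr.eval_add, Expr.eval_sub, Expr.eval_mul,
      Expr.eval_div, Expr.eval_reg, Expr.eval_cell, Expr.eval_floor, Expr.eval_one,
      Mem.reg_setReg, Mem.arr_setReg, Mem.reg_setArr, hM₁, he₁.cube, he₁.row, h₁, h₂, h₃, h₄,
      floor_address, floor_natCast_div, cast_digit, Nat.floor_natCast, hv, Nat.reduceEqDiff,
      if_true, if_false, Nat.cast_lt]
    have hdiv : c / (2 ^ d) ^ t / 2 ^ d = c / (2 ^ d) ^ (t + 1) := by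
      rw [Nat.div_div_eq_div_mul, pow_succ]
    rw [sel]
    split_ifs with h
    · have hpred : ((f t : ℕ) : ℝ) - 1 = ((f t - 1 : ℕ) : ℝ) := by
        rw [Nat.cast_sub (by omega), Nat.cast_one]
      have hcode : ((codeStep (code (sel f t).1) (f t - 1) : ℕ) : ℝ) =
          (code (sel f t).1 + f t) * (code (sel f t).1 + f t) + f t := by
        unfold codeStep
        rw [Nat.sub_add_cancel (by omega)]
        push_cast
        rfl
      simp only [Mem.reg_setReg, Mem.arr_setReg, Mem.reg_setArr, Mem.arr_setArr, h₁, h₂, h₃, h₄,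
        Nat.reduceEqDiff, if_true, if_false, true_and, hdiv, code_append_singleton, hcode,
        hpred]
      refine ⟨by simp, ?_, ?_⟩
      · intro i hi
        rw [List.length_append, List.length_singleton] at hi
        rcases Nat.lt_succ_iff_lt_or_eq.1 hi with h' | rfl
        · simp [h'.ne, h₅ i h', List.getElem_append_left h']
        · simp
      · intro j hj
        have : j ≠ M * (k + 1) + (sel f t).1.length := by omega
        simp [this, h₆ j hj]
    · simp only [Mem.reg_setReg, Mem.arr_setReg, h₂, h₃, h₄, Nat.reduceEqDiff, if_true,
        if_false, hdiv, true_and]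
      exact ⟨h₅, h₆⟩

theorem tupleAccept_spec {k : ℕ} {m : Mem} {S : List (List ℕ)} {s : List ℕ}
    (hS : SimpRep k S m) (hh : m.reg rHash = code s) (hl : m.reg rLen = s.length)
    (hs : s.length ≤ k + 1)
    (hv : ∀ t (h : t < s.length), m.arr aSimp (S.length * (k + 1) + t) = s[t]) :
    HT tupleAccept m 30 fun m' => ∃ S', SimpRep k S' m' ∧
      ∀ r, r ∈ S' ↔ r ∈ S ∨ r ≠ [] ∧ r = s := by
  have hmem : m.arr aSimpTab (code s) = 0 ↔ s ∉ S := by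
    rw [hS.tab]; split_ifs with h <;> simp [h]
  refine HT.of_loopless rfl (by decide) ?_
  simp only [tupleAccept, Prog.exec, Test.Holds, Expr.eval_reg, Expr.eval_cell, Expr.eval_zero,
    Expr.eval_add, Expr.eval_one, hh, hl, Nat.floor_natCast, hmem, hS.count, Mem.reg_setArr]
  split_ifs with h₁ h₂
  · refine ⟨S, hS, fun r => ⟨Or.inl, ?_⟩⟩
    rintro (h | ⟨-, rfl⟩)
    exacts [h, h₂]
  · have hne : s ≠ [] := List.ne_nil_of_length_pos (by exact_mod_cast h₁)
    have hget : ∀ a (h : a < (S ++ [s]).length), a < S.length ∨ a = S.length := by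
      intro a h
      rw [List.length_append, List.length_singleton] at h
      omega
    refine ⟨S ++ [s], ⟨?_, ?_, ?_, ?_, ?_, ?_⟩, ?_⟩
    · rw [List.nodup_append]
      exact ⟨hS.nodup, by simp, fun a ha b hb => by
        rintro rfl; exact h₂ (List.mem_singleton.1 hb ▸ ha)⟩
    · simp [Mem.reg_setReg]
    · intro b h
      rcases hget b h with h' | rfl
      · simp [Mem.arr_setReg, Mem.arr_setArr, hS.card b h', List.getElem_append_left h', h'.ne]
      · simp [Mem.arr_setReg, Mem.arr_setArr]
    · intro r hr
      rcases List.mem_append.1 hr with hr | hr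
      · exact hS.len r hr
      · rw [List.mem_singleton.1 hr]; exact hs
    · intro b h t ht
      rcases hget b h with h' | rfl
      · simp only [List.getElem_append_left h'] at ht ⊢
        simp [Mem.arr_setReg, Mem.arr_setArr, hS.vertex b h' t ht]
      · simp only [List.getElem_concat_length] at ht ⊢
        simp [Mem.arr_setReg, Mem.arr_setArr, hv t ht]
    · intro r
      by_cases hr : r = s
      · simp [Mem.arr_setReg, Mem.arr_setArr, hr]
      · simp [Mem.arr_setReg, Mem.arr_setArr, code_injective.eq_iff, hr, hS.tab]
    · intro r
      simp only [List.mem_append, List.mem_singleton]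
      refine or_congr_right ⟨?_, And.right⟩
      rintro rfl
      exact ⟨hne, rfl⟩
  · have hnil : s = [] := by
      by_contra h
      exact h₁ (by exact_mod_cast List.length_pos_of_ne_nil h)
    exact ⟨S, hS, fun r => by simp [hnil]⟩

theorem tupleProg_spec {d n k : ℕ} {s α ρ : ℝ} {K : ℕ} {p : ℕ → ℕ → ℝ} {m : Mem}
    (he : Env d n k s α ρ K p m) {U : ℕ → ℕ} (hU : ∀ e < 2 ^ d, m.arr aNbr e = U e)
    {S : List (List ℕ)} (hS : SimpRep k S m) :
    HT tupleProg m ((2 ^ d) ^ (k + 1) * ((k + 1) * 69 + 69) + 7) fun m' =>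
      ∃ S', SimpRep k S' m' ∧ ∀ r, r ∈ S' ↔ r ∈ S ∨ r ≠ [] ∧ r.Pairwise (· < ·) ∧
        r.length ≤ k + 1 ∧ ∀ u ∈ r, ∃ e < 2 ^ d, U e = u + 1 := by
  refine (HT.forLoop (p := tupleTry) ((2 ^ d) ^ (k + 1)) ((k + 1) * 69 + 60)
    (fun c m' => ∃ S', SimpRep k S' m' ∧ ∀ r, r ∈ S' ↔ r ∈ S ∨ r ≠ [] ∧
      ∃ c' < c, r = (sel (tuple U (2 ^ d) c') (k + 1)).1)
    (by decide) (by decide) (by decide) he.tuples ?_ ?_).mono le_rfl ?_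
  · exact ⟨S, hS.congr (by simp [Mem.reg_setReg]) rfl rfl rfl, by simp⟩
  · rintro c - m₁ hf hc - ⟨S', hS', hmem'⟩
    refine HT.seq (T₁ := 15) (T₂ := (k + 1) * 69 + 44) (HT.of_loopless (Q := fun m' =>
      m'.reg rQ = c ∧ m'.reg rHash = 0 ∧ m'.reg rPrev = 0 ∧ m'.reg rLen = 0 ∧
      m'.arr = m₁.arr) rfl (by decide) ?_) (by omega) ?_
    · simp [Prog.exec, Mem.reg_setReg, Mem.arr_setReg, Expr.eval_reg, Expr.eval_zero, hc]
    rintro m₂ hf₂ ⟨h₁, h₂, h₃, h₄, h₅⟩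
    have he₂ := (he.frame hf (by decide) (by decide)).frame hf₂ (by decide) (by decide)
    have hS₂ : SimpRep k S' m₂ := hS'.congr (hf₂.reg _ (by decide)) (by rw [h₅]) (by rw [h₅])
      (by rw [h₅])
    have hU₂ : ∀ e < 2 ^ d, m₂.arr aNbr e = U e := by
      rw [h₅, hf.arr _ (by decide)]; exact hU
    refine (tupleLoop_spec he₂ hU₂ hS₂.count h₁ h₂ h₃ h₄).seq (T₂ := 30) (by omega) ?_
    rintro m₃ hf₃ ⟨h₆, h₇, h₈, h₉⟩
    -- Only the first unused row has been written.
    have hS₃ : SimpRep k S' m₃ := by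
      refine ⟨hS₂.nodup, ?_, ?_, hS₂.len, ?_, ?_⟩
      · rw [hf₃.reg _ (by decide), hS₂.count]
      · rw [hf₃.arr _ (by decide)]; exact hS₂.card
      · intro b h t ht
        have := hS₂.len _ (List.getElem_mem h)
        rw [h₉ _ ?_, hS₂.vertex b h t ht]
        calc b * (k + 1) + t < b * (k + 1) + (k + 1) := by omega
          _ = (b + 1) * (k + 1) := by ring
          _ ≤ S'.length * (k + 1) := Nat.mul_le_mul_right _ h
      · rw [hf₃.arr _ (by decide)]; exact hS₂.tab
    refine (tupleAccept_spec hS₃ h₆ h₇ (sel_spec _ _).2.1 h₈).mono le_rfl ?_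
    rintro m₄ - ⟨S₄, hS₄, hmem₄⟩
    refine ⟨S₄, hS₄.congr (by simp [Mem.reg_setReg]) rfl rfl rfl, fun r => ?_⟩
    rw [hmem₄, hmem', or_assoc, ← and_or_left]
    refine or_congr_right (and_congr_right fun _ => ?_)
    constructor
    · rintro (⟨c', h, h'⟩ | h')
      · exact ⟨c', by omega, h'⟩
      · exact ⟨c, by omega, h'⟩
    · rintro ⟨c', h, h'⟩
      rcases Nat.lt_succ_iff_lt_or_eq.1 h with h | rfl
      · exact Or.inl ⟨c', h, h'⟩
      · exact Or.inr h'
  · rintro m' - ⟨S', hS', hmem'⟩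
    refine ⟨S', hS', fun r => ?_⟩
    rw [hmem']
    exact or_congr_right (and_congr_right fun hne => exists_sel_tuple_iff (by positivity) hne)

/-- The listed simplices are the sets of at most `k + 1` listed pixels around any lattice point:
a lattice point in a listed pixel is one of the `2 ^ d` lattice points at that pixel. -/
theorem simpProg_spec {d n k : ℕ} {s ε α ρ : ℝ} {K : ℕ} {p : ℕ → ℕ → ℝ} {m : Mem}
    (he : Env d n k s α ρ K p m) {L : List (Fin d → ℤ)} (hL : PixRep ε α L m)
    (hS : SimpRep k [] m) :
    HT simpProg m (L.length * (2 ^ d * (2 ^ d * (d * 109 + 49) +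
      (2 ^ d) ^ (k + 1) * ((k + 1) * 69 + 69) + 24) + 16) + 7) fun m' =>
      PixRep ε α L m' ∧ ∃ S, SimpRep k S m' ∧ ∀ r, r ∈ S ↔ ∃ w, Around L k w r := by
  set T := 2 ^ d * (d * 109 + 49) + (2 ^ d) ^ (k + 1) * ((k + 1) * 69 + 69) + 15 with hT
  refine (HT.forLoop (p := .forLoop rB rCube (nbrProg ;; tupleProg)) L.length
    (2 ^ d * (T + 9) + 7)
    (fun a m' => ∃ S, SimpRep k S m' ∧ ∀ r, r ∈ S ↔ ∃ (a' : ℕ) (h : a' < L.length),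
      a' < a ∧ ∃ b < 2 ^ d, Around L k (cornerVec L[a'] b) r)
    (by decide) (by decide) (by decide) hL.count ?_ ?_).mono le_rfl ?_
  · exact ⟨[], hS.congr (by simp [Mem.reg_setReg]) rfl rfl rfl, by simp⟩
  · rintro a ha m₁ hf hra - ⟨S, hS₁, hmem⟩
    have he₁ := he.frame hf (by decide) (by decide)
    refine (HT.forLoop (p := nbrProg ;; tupleProg) (2 ^ d) T
      (fun b m' => ∃ S', SimpRep k S' m' ∧ ∀ r, r ∈ S' ↔ r ∈ S ∨
        ∃ b' < b, Around L k (cornerVec L[a] b') r)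
      (by decide) (by decide) (by decide) he₁.cube ?_ ?_).mono le_rfl ?_
    · exact ⟨S, hS₁.congr (by simp [Mem.reg_setReg]) rfl rfl rfl, by simp⟩
    · rintro b - m₂ hf₂ hrb - ⟨S', hS', hmem'⟩
      have he₂ := he₁.frame hf₂ (by decide) (by decide)
      have hL₂ : PixRep ε α L m₂ := by
        refine (hL.congr ?_ ?_ ?_ ?_ : PixRep ε α L m₁).congr ?_ ?_ ?_ ?_ <;>
          first | exact hf.reg _ (by decide) | exact hf₂.reg _ (by decide) |
            exact hf.arr _ (by decide) | exact hf₂.arr _ (by decide)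
      refine (nbrProg_spec he₂ hL₂ (by rw [hf₂.reg _ (by decide), hra]) ha hrb).seq
        (T₂ := (2 ^ d) ^ (k + 1) * ((k + 1) * 69 + 69) + 7) (by omega) ?_
      intro m₃ hf₃ hU
      have he₃ := he₂.frame hf₃ (by decide) (by decide)
      have hS₃ : SimpRep k S' m₃ := hS'.congr (hf₃.reg _ (by decide)) (hf₃.arr _ (by decide))
        (hf₃.arr _ (by decide)) (hf₃.arr _ (by decide))
      refine (tupleProg_spec he₃ hU hS₃).mono le_rfl ?_
      rintro m₄ - ⟨S₄, hS₄, hmem₄⟩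
      refine ⟨S₄, hS₄.congr (by simp [Mem.reg_setReg]) rfl rfl rfl, fun r => ?_⟩
      have hiff : (∀ u ∈ r, ∃ e < 2 ^ d,
          lookup L (aroundVec (cornerVec L[a] b) e) = u + 1) ↔
          ∀ u ∈ r, ∃ h : u < L.length, ∀ l, cornerVec L[a] b l - 1 ≤ L[u] l ∧
            L[u] l ≤ cornerVec L[a] b l := by
        refine forall₂_congr fun u _ => ?_
        simp only [lookup_eq_succ_iff hL.nodup]
        constructor
        · rintro ⟨e, -, h, he⟩
          refine ⟨h, fun l => ?_⟩
          rw [he]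
          exact aroundVec_bounds _ _ _
        · rintro ⟨h, h'⟩
          obtain ⟨e, he, he'⟩ := exists_aroundVec h'
          exact ⟨e, he, h, he'⟩
      rw [hmem₄, hmem', or_assoc, hiff]
      refine or_congr_right ?_
      constructor
      · rintro (⟨b', h, h'⟩ | h')
        · exact ⟨b', by omega, h'⟩
        · exact ⟨b, by omega, h'⟩
      · rintro ⟨b', h, h'⟩
        rcases Nat.lt_succ_iff_lt_or_eq.1 h with h | rfl
        · exact Or.inl ⟨b', h, h'⟩
        · exact Or.inr h'
    · rintro m₂ - ⟨S', hS', hmem'⟩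
      refine ⟨S', hS'.congr (by simp [Mem.reg_setReg]) rfl rfl rfl, fun r => ?_⟩
      rw [hmem', hmem]
      constructor
      · rintro (⟨a', h, h', h''⟩ | h')
        · exact ⟨a', h, by omega, h''⟩
        · exact ⟨a, ha, by omega, h'⟩
      · rintro ⟨a', h, h', h''⟩
        rcases Nat.lt_succ_iff_lt_or_eq.1 h' with h' | rfl
        · exact Or.inl ⟨a', h, h', h''⟩
        · exact Or.inr h''
  · rintro m' hf ⟨S, hS', hmem⟩
    refine ⟨hL.congr (hf.reg _ (by decide)) (hf.arr _ (by decide)) (hf.arr _ (by decide))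
      (hf.arr _ (by decide)), S, hS', fun r => ?_⟩
    rw [hmem]
    constructor
    · rintro ⟨a, _, -, b, -, h⟩
      exact ⟨_, h⟩
    · rintro ⟨w, h⟩
      -- Any vertex of the simplex can serve as the pixel from which `w` is reached.
      obtain ⟨u, hu⟩ := List.exists_mem_of_ne_nil r h.1
      obtain ⟨hlt, hw⟩ := h.2.2.2 u hu
      obtain ⟨b, hb, hb'⟩ := exists_cornerVec hw
      exact ⟨u, hlt, hlt, b, hb, hb' ▸ h⟩

end PixelTower

/-! ### The complete program -/

-- The grid scales at `α` and at `(1 + ε) α`.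
notation "rGrid" => (31 : ℕ)
notation "rNext" => (32 : ℕ)

namespace PixelTower

open RealRAM

/-- Compute the constants. The powers `a ^ b` are computed as `exp (b log a)`, which is exact. -/
def initProg : Prog :=
  .set rGrid (.exp (.log 2 * .floor (.log (.reg rAlpha) / .log 2))) ;;
  .set rNext (.exp (.log 2 * .floor (.log ((1 + .reg rEps) * .reg rAlpha) / .log 2))) ;;
  .set rSide (.reg rEps * .reg rGrid / (4 * .sqrt (.reg rDim))) ;;
  .set rRatio (.reg rGrid / .reg rNext) ;;
  .set rWidth (.floor (2 * .reg rAlpha / .reg rSide) + 2) ;;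
  .set rBox (.exp (.reg rDim * .log (.reg rWidth))) ;;
  .set rCube (.exp (.reg rDim * .log 2)) ;;
  .set rRow (.reg rSkel + 1) ;;
  .set rTuples (.exp (.reg rRow * .log (.reg rCube)))

/-- The whole computation; at the end the two counts are moved to the output registers. -/
def mainProg : Prog :=
  initProg ;; pixProg ;; simpProg ;; .set rDim (.reg rPix) ;; .set rNum (.reg rSimp)

/-- The coordinates of the points, as a function on the natural numbers. -/
noncomputable def points {d n : ℕ} (P : Fin n → EuclideanSpace ℝ (Fin d)) (i l : ℕ) : ℝ :=
  if h : i < n ∧ l < d then P ⟨i, h.1⟩ ⟨l, h.2⟩ else 0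

theorem exp_mul_log_natCast {a : ℕ} (ha : 0 < a) (b : ℕ) :
    Real.exp (b * Real.log a) = ((a ^ b : ℕ) : ℝ) := by
  rw [Real.exp_nat_mul, Real.exp_log (by exact_mod_cast ha), Nat.cast_pow]

theorem initProg_spec {d n : ℕ} (k : ℕ) {ε α : ℝ} (P : Fin n → EuclideanSpace ℝ (Fin d))
    (hd : 1 ≤ d) (hε : 0 < ε) (hα : 0 < α) :
    HT initProg (inputMem k ε α P) 100 fun m =>
      Env d n k (side d ε α) α (ratio ε α) (width d ε α) (points P) m ∧
      PixRep (d := d) ε α [] m ∧ SimpRep k [] m := by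
  have hr : ∀ r, (inputMem k ε α P).reg r = if r = 0 then (d : ℝ) else if r = 1 then (n : ℝ)
    else if r = 2 then (k : ℝ) else if r = 3 then ε else if r = 4 then α else 0 := fun _ => rfl
  have ha : ∀ a, a ≠ 0 → (inputMem k ε α P).arr a = 0 := by
    intro a h
    ext j
    exact dif_neg fun h' => h h'.1
  have hs := side_pos α hd hε
  have hβ := (gridScale_eq_exp hα).symm
  have hβ' := (gridScale_eq_exp (show 0 < (1 + ε) * α by positivity)).symm
  have hside : ε * gridScale α / (4 * √(d : ℝ)) = side d ε α := rfl
  have hratio : gridScale α / gridScale ((1 + ε) * α) = ratio ε α := rfl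
  have hwidth : (⌊2 * α / side d ε α⌋ : ℝ) + 2 = width d ε α := by
    rw [width, Nat.cast_add, natCast_floor_eq_intCast_floor (by positivity), Nat.cast_two]
  have hpos : 0 < width d ε α := by unfold width; omega
  have hbox := exp_mul_log_natCast hpos d
  have hcube : Real.exp (d * Real.log 2) = ((2 ^ d : ℕ) : ℝ) := by
    have := exp_mul_log_natCast two_pos d
    rwa [Nat.cast_two] at this
  have hrow : (k : ℝ) + 1 = ((k + 1 : ℕ) : ℝ) := by push_cast; rfl
  have htup := exp_mul_log_natCast (show 0 < 2 ^ d by positivity) (k + 1)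
  refine (HT.of_loopless rfl (by decide : _ ≤ 100) (Q := fun m =>
    m.reg = (initProg.exec (inputMem k ε α P)).reg ∧ m.arr = (inputMem k ε α P).arr)
    ⟨rfl, rfl⟩).mono le_rfl ?_
  rintro m - ⟨hm, hm'⟩
  simp only [initProg, Prog.exec, Expr.eval_add, Expr.eval_mul, Expr.eval_div, Expr.eval_reg,
    Expr.eval_floor, Expr.eval_one, Expr.eval_two, Expr.eval_four, Expr.eval_exp, Expr.eval_log,
    Expr.eval_sqrt, Mem.reg_setReg, hr, Nat.reduceEqDiff, if_true, if_false,
    OfNat.ofNat_ne_zero, OfNat.ofNat_ne_one, OfNat.zero_ne_ofNat,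
    hβ, hβ', hside, hratio, hwidth, hbox, hcube, hrow, htup] at hm
  refine ⟨⟨?_, ?_, ?_, ?_, ?_, ?_, ?_, ?_, ?_, ?_, ?_⟩, ⟨by simp, ?_, by simp, by simp, by simp, ?_⟩,
    ⟨by simp, ?_, by simp, by simp, by simp, ?_⟩⟩
  case refine_11 =>
    intro i hi l hl
    rw [hm']
    have h₁ : (i * d + l) / d = i := by
      rw [mul_comm, Nat.mul_add_div (by omega), Nat.div_eq_of_lt hl, add_zero]
    have h₂ : (i * d + l) % d = l := by
      rw [mul_comm, Nat.mul_add_mod, Nat.mod_eq_of_lt hl]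
    have h₃ : 0 < d := by omega
    simp only [inputMem, points, h₁, h₂, hi, hl, h₃, and_self, dif_pos]
  all_goals first
    | (rw [hm]; simp [Mem.reg_setReg, hr])
    | (intro z; rw [hm', ha _ (by norm_num)]; simp)

/-- An increasing list of positions below `N` has as many entries as the set of positions that it
spans. -/
theorem simplex_card {N : ℕ} {s : List ℕ} (hs : s.Pairwise (· < ·)) (hN : ∀ u ∈ s, u < N) :
    (Finset.univ.filter fun a : Fin N => (a : ℕ) ∈ s).card = s.length := by
  have : (Finset.univ.filter fun a : Fin N => (a : ℕ) ∈ s).map Fin.valEmbedding =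
      s.toFinset := by
    ext u
    simp only [Finset.mem_map, Finset.mem_filter, Finset.mem_univ, true_and,
      Fin.valEmbedding_apply, List.mem_toFinset]
    exact ⟨by rintro ⟨a, h, rfl⟩; exact h, fun h => ⟨⟨u, hN u h⟩, h, rfl⟩⟩
  rw [← Finset.card_map Fin.valEmbedding, this, List.toFinset_card_of_nodup]
  exact hs.imp fun h => h.ne

/-- A memory that holds a list of the close pixels and a list of all increasing lists of pixels
around lattice points holds the skeleton and the connecting map. -/
theorem holds_of_reps {d n k : ℕ} {ε α : ℝ} {P : Fin n → EuclideanSpace ℝ (Fin d)}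
    (hd : 1 ≤ d) (hε : 0 < ε) (hε' : ε ≤ 1 / 5) (hα : 0 < α) {m : Mem} {L : List (Fin d → ℤ)}
    {S : List (List ℕ)} (hL : PixRep ε α L m) (hS : SimpRep k S m) (h₀ : m.reg 0 = L.length)
    (h₁ : m.reg 1 = S.length)
    (hmem : ∀ z, z ∈ L ↔ ∃ i, dist (center (side d ε α) z) (P i) ≤ α)
    (hmem' : ∀ s, s ∈ S ↔ ∃ w, Around L k w s) : HoldsSkeletonAndMap m k ε α P := by
  classical
  have hs := side_pos α hd hε
  let pix : Fin L.length → Fin d → ℤ := fun a => L[a]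
  let simp' : Fin S.length → Finset (Fin L.length) := fun b =>
    Finset.univ.filter fun a => (a : ℕ) ∈ S[b]
  have hpix : Function.Injective fun a => pixel (side d ε α) (pix a) := by
    intro a b h
    exact Fin.ext ((hL.nodup.getElem_inj_iff).1 (pixel_injective hs h))
  have hpm : ∀ a, pixel (side d ε α) (pix a) ∈ pixels ε P α := fun a =>
    ⟨_, rfl, (hmem _).1 (List.getElem_mem _)⟩
  have haround : ∀ b : Fin S.length, ∃ w, Around L k w S[b] := fun b =>
    (hmem' _).1 (List.getElem_mem _)
  have hsorted : ∀ b : Fin S.length, S[b].Pairwise (· < ·) := fun b => by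
    obtain ⟨w, hw⟩ := haround b
    exact hw.2.1
  have hlt : ∀ b : Fin S.length, ∀ u ∈ S[b], u < L.length := fun b u hu => by
    obtain ⟨w, hw⟩ := haround b
    exact (hw.2.2.2 u hu).1
  have hcard : ∀ b, (simp' b).card = S[b].length := fun b =>
    simplex_card (hsorted b) (hlt b)
  obtain ⟨g, hg, hg'⟩ := exists_connectingMap hd hε hε' hα P
  refine ⟨L.length, S.length, pix, simp', fun a => nextVec ε α (pix a),
    ⟨h₀, fun a l => hL.coord a a.2 l, h₁, ?_, ?_, fun a l => hL.img a a.2 l⟩, ?_, ?_,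
    g, hg, fun a => hg' _⟩
  · intro b
    rw [hcard]
    exact hS.card b b.2
  · intro b t
    have ht : (t : ℕ) < S[b].length := by rw [← hcard]; exact t.2
    let f : Fin (simp' b).card → Fin L.length := fun t =>
      ⟨S[b][(t : ℕ)]'(by rw [← hcard]; exact t.2), hlt b _ (List.getElem_mem _)⟩
    have hf := Finset.orderEmbOfFin_unique (s := simp' b) rfl (f := f)
      (fun x => by simp [simp', f]) (fun x y h =>
        List.pairwise_iff_getElem.1 (hsorted b) x y _ _ h)
    rw [← hf]
    exact hS.vertex b b.2 t ht
  · refine ⟨fun a _ => hpm a, hpix.injOn, ?_⟩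
    rintro _ ⟨z, rfl, h⟩
    obtain ⟨a, ha, rfl⟩ := List.getElem_of_mem ((hmem z).2 h)
    exact ⟨⟨a, ha⟩, trivial, rfl⟩
  · refine ⟨?_, ?_, ?_⟩
    · intro b _
      obtain ⟨w, hne, -, hlen, hw⟩ := haround b
      refine ⟨⟨?_, ?_, ?_⟩, ?_⟩
      · rw [Finset.image_nonempty, ← Finset.card_pos, hcard]
        exact List.length_pos_of_ne_nil hne
      · intro C hC
        simp only [Finset.coe_image, Set.mem_image] at hC
        obtain ⟨a, -, rfl⟩ := hC
        exact hpm a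
      · refine ⟨WithLp.toLp 2 fun l => side d ε α * (w l : ℝ), ?_⟩
        simp only [Finset.mem_image, Set.mem_iInter, forall_exists_index, and_imp]
        rintro _ a ha rfl
        obtain ⟨_, h⟩ := hw a (Finset.mem_filter.1 ha).2
        exact mem_pixel_of_corner hs h
      · exact Finset.card_image_le.trans ((hcard b).trans_le hlen)
    · intro b _ b' _ h
      have h := Finset.image_injective hpix h
      have hmem_iff : ∀ u, u ∈ S[b] ↔ u ∈ S[b'] := by
        intro u
        constructor <;> intro hu
        · have : (⟨u, hlt b u hu⟩ : Fin L.length) ∈ simp' b' := by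
            rw [← h]; simpa [simp'] using hu
          simpa [simp'] using this
        · have : (⟨u, hlt b' u hu⟩ : Fin L.length) ∈ simp' b := by
            rw [h]; simpa [simp'] using hu
          simpa [simp'] using this
      have hnd : ∀ b : Fin S.length, S[b].Nodup := fun b => (hsorted b).imp fun h => h.ne
      have heq : S[b] = S[b'] := by
        refine List.Perm.eq_of_pairwise (le := (· < ·)) ?_ (hsorted b) (hsorted b')
          ((List.perm_ext_iff_of_nodup (hnd b) (hnd b')).2 hmem_iff)
        intro x y _ _ h h'
        omega
      exact Fin.ext ((hS.nodup.getElem_inj_iff).1 heq)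
    · rintro σ ⟨⟨hne, hsub, x, hx⟩, hc⟩
      let A : Finset (Fin L.length) :=
        Finset.univ.filter fun a => pixel (side d ε α) (pix a) ∈ σ
      have hA : A.image (fun a => pixel (side d ε α) (pix a)) = σ := by
        ext C
        simp only [A, Finset.mem_image, Finset.mem_filter, Finset.mem_univ, true_and]
        constructor
        · rintro ⟨a, h, rfl⟩
          exact h
        · intro hC
          obtain ⟨z, rfl, h⟩ := hsub hC
          obtain ⟨a, ha, rfl⟩ := List.getElem_of_mem ((hmem z).2 h)
          exact ⟨⟨a, ha⟩, hC, rfl⟩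
      have hAne : A.Nonempty := Finset.image_nonempty.1 (hA ▸ hne)
      have hAx : ∀ a ∈ A, x ∈ pixel (side d ε α) (pix a) := fun a ha =>
        Set.mem_iInter₂.1 hx _ (Finset.mem_filter.1 ha).2
      let s := (A.map Fin.valEmbedding).sort
      have hsm : ∀ a : Fin L.length, (a : ℕ) ∈ s ↔ a ∈ A := by
        intro a
        simp only [s, Finset.mem_sort, Finset.mem_map, Fin.valEmbedding_apply]
        exact ⟨by rintro ⟨b, h, h'⟩; exact Fin.ext h' ▸ h, fun h => ⟨a, h, rfl⟩⟩
      have hsS : s ∈ S := by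
        rw [hmem']
        -- The coordinatewise maximum is a lattice point common to all pixels of the simplex.
        refine ⟨fun l => A.sup' hAne fun a => pix a l, ?_, ?_, ?_, ?_⟩
        · obtain ⟨a, ha⟩ := hAne
          exact List.ne_nil_of_mem ((hsm a).2 ha)
        · exact Finset.sortedLT_sort _ |>.pairwise
        · rw [Finset.length_sort, Finset.card_map, ← Finset.card_image_of_injective A hpix, hA]
          exact hc
        · intro u hu
          obtain ⟨a, ha, rfl⟩ := Finset.mem_map.1 ((Finset.mem_sort _).1 hu)
          refine ⟨a.2, fun l => ⟨?_, Finset.le_sup' (fun a => pix a l) ha⟩⟩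
          obtain ⟨a', ha', h⟩ := Finset.exists_mem_eq_sup' hAne fun a => pix a l
          change A.sup' hAne (fun a => pix a l) - 1 ≤ pix a l
          rw [h]
          have : pix a' l ≤ pix a l + 1 :=
            le_add_one_of_mem_pixel hs (hAx a' ha') (hAx a ha) l
          exact sub_le_iff_le_add.2 this
      obtain ⟨b, hb, hb'⟩ := List.getElem_of_mem hsS
      refine ⟨⟨b, hb⟩, trivial, ?_⟩
      change (simp' ⟨b, hb⟩).image _ = σ
      rw [← hA]
      congr 1
      ext a
      rw [← hsm]
      simp [simp', hb']

/-- The bound comes from `2 α / s = 8 √d α / (ε β)` with the grid scale `β > α / 2`, and `√d ≤ d`;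
replacing `√d` by `d` only affects the constant in `2 ^ O(d log d)`. -/
theorem width_le {d : ℕ} {ε α : ℝ} (hd : 1 ≤ d) (hε : 0 < ε) (hε' : ε ≤ 1 / 5) (hα : 0 < α) :
    (width d ε α : ℝ) ≤ 18 * d * (1 / ε) := by
  have hd' : (1 : ℝ) ≤ d := by exact_mod_cast hd
  have hβ := gridScale_pos α
  have hβ' := lt_two_mul_gridScale α
  have hs := side_pos α hd hε
  have hsq : √(d : ℝ) ≤ d := by
    rw [Real.sqrt_le_left (by linarith)]; nlinarith
  have hsq' : 0 < √(d : ℝ) := Real.sqrt_pos.2 (by linarith)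
  have h₁ : 2 * α / side d ε α ≤ 16 * d * (1 / ε) := by
    rw [div_le_iff₀ hs]
    have : 16 * (d : ℝ) * (1 / ε) * side d ε α = 4 * gridScale α * (d / √(d : ℝ)) := by
      unfold side; field_simp; ring
    rw [this]
    have : 1 ≤ (d : ℝ) / √(d : ℝ) := by rwa [le_div_iff₀ hsq', one_mul]
    nlinarith
  have h₂ : (1 : ℝ) ≤ d * (1 / ε) := by
    have : 1 ≤ 1 / ε := by rw [le_div_iff₀ hε]; linarith
    nlinarith
  have h₃ := Nat.floor_le (show 0 ≤ 2 * α / side d ε α by positivity)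
  unfold width
  push_cast
  linarith

/-- The sum of the budgets of all phases, with `X` candidates for each point, `N` listed pixels,
`Y = 2 ^ d` lattice points at each pixel and `Z` tuples for each lattice point. -/
theorem steps_le {d n k X N Y Z : ℕ} (hd : 1 ≤ d) (hn : 1 ≤ n) (hX : 1 ≤ X) (hN : N ≤ n * X)
    (hY : 1 ≤ Y) (hYZ : Y ≤ Z) :
    100 + (n * (X * (d * 159 + 69) + 16) + 7) + (N * (Y * (Y * (d * 109 + 49) +
      Z * ((k + 1) * 69 + 69) + 24) + 16) + 7) + 20 ≤
      1000 * (n * X * (Y * Z) * (d * (k + 1))) := by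
  have hZ1 : 1 ≤ Z := hY.trans hYZ
  have hE : 1 ≤ d * (k + 1) := Nat.mul_pos hd (by omega)
  have hdE : d ≤ d * (k + 1) := Nat.le_mul_of_pos_right _ (by omega)
  have hkE : k + 1 ≤ d * (k + 1) := Nat.le_mul_of_pos_left _ hd
  generalize d * (k + 1) = E at *
  have hnX : 1 ≤ n * X := Nat.mul_pos hn hX
  have hYZ1 : 1 ≤ Y * Z := Nat.mul_pos hY hZ1
  have hZE : 1 ≤ Z * E := Nat.mul_pos hZ1 hE
  have h₁ : Y * (d * 109 + 49) + Z * ((k + 1) * 69 + 69) + 24 ≤ 320 * (Z * E) := by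
    have a₁ : Y * (d * 109 + 49) ≤ Z * (E * 158) := Nat.mul_le_mul hYZ (by omega)
    have a₂ : Z * ((k + 1) * 69 + 69) ≤ Z * (E * 138) := Nat.mul_le_mul_left _ (by omega)
    linarith
  have h₂ : Y * (Y * (d * 109 + 49) + Z * ((k + 1) * 69 + 69) + 24) + 16 ≤
      336 * (Y * Z * E) := by
    have a₁ := Nat.mul_le_mul_left Y h₁
    have a₃ : 1 ≤ Y * Z * E := Nat.mul_pos hYZ1 hE
    linarith
  have h₃ := Nat.mul_le_mul hN h₂
  have h₅ : X * (d * 159 + 69) + 16 ≤ 244 * (X * E) := by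
    have a₁ : X * (d * 159 + 69) ≤ X * (E * 228) := Nat.mul_le_mul_left _ (by omega)
    have a₃ : 1 ≤ X * E := Nat.mul_pos hX hE
    linarith
  have h₆ := Nat.mul_le_mul_left n h₅
  have h₈ : n * X * E ≤ n * X * (Y * Z) * E :=
    Nat.mul_le_mul_right _ (Nat.le_mul_of_pos_right _ hYZ1)
  have h₉ : 1 ≤ n * X * (Y * Z) * E := Nat.mul_pos (Nat.mul_pos hnX hYZ1) hE
  linarith

/-- The count of steps in the required form. The factors `18 ^ d`, `2 ^ O(d + d k)`, `d` and `k + 1`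
go into one power of two. -/
theorem time_le {d n k K : ℕ} {ε : ℝ} (hd : 1 ≤ d) (hε : 0 < ε)
    (hK : (K : ℝ) ≤ 18 * d * (1 / ε)) :
    ((1000 * (n * K ^ d * (2 ^ d * (2 ^ d) ^ (k + 1)) * (d * (k + 1))) : ℕ) : ℝ) ≤
      256000 * (n * (1 / ε) ^ d * (2 : ℝ) ^ ((256000 : ℝ) * (d * Real.log d + d * k))) := by
  have hd' : (1 : ℝ) ≤ d := by exact_mod_cast hd
  have hlog2 : (1 / 2 : ℝ) ≤ Real.log 2 := by have := Real.log_two_gt_d9; linarith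
  have hlogd : 0 ≤ Real.log d := Real.log_nonneg hd'
  have hdl : 0 ≤ d * Real.log d := by positivity
  have hdk : (0 : ℝ) ≤ d * k := by positivity
  have hdd : (d : ℝ) ^ d ≤ (2 : ℝ) ^ (2 * (d * Real.log d)) := by
    rw [Real.rpow_def_of_pos two_pos]
    nth_rw 1 [← Real.exp_log (show (0 : ℝ) < d by linarith)]
    rw [← Real.exp_nat_mul]
    apply Real.exp_le_exp.2
    nlinarith
  have hrest : 18 ^ d * ((2 ^ d * (2 ^ d) ^ (k + 1)) * (d * (k + 1))) ≤
      2 ^ (8 * d + 2 * (d * k)) := by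
    have h₁ : 18 ^ d ≤ 2 ^ (5 * d) := by
      rw [pow_mul]; exact Nat.pow_le_pow_left (by norm_num) d
    have h₂ : d ≤ 2 ^ d := Nat.lt_two_pow_self.le
    have h₃ : k + 1 ≤ 2 ^ (d * k) :=
      le_trans Nat.lt_two_pow_self (Nat.pow_le_pow_right two_pos (Nat.le_mul_of_pos_left _ hd))
    calc 18 ^ d * ((2 ^ d * (2 ^ d) ^ (k + 1)) * (d * (k + 1)))
        ≤ 2 ^ (5 * d) * ((2 ^ d * (2 ^ d) ^ (k + 1)) * (2 ^ d * 2 ^ (d * k))) := by gcongr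
      _ = 2 ^ (8 * d + 2 * (d * k)) := by ring
  -- The term `d` is absorbed by `d log d`, except for `d = 1`, where it is a constant.
  have hd8 : (8 : ℝ) * d ≤ 8 + 16 * (d * Real.log d) := by
    rcases Nat.lt_or_ge 1 d with h | h
    · have : Real.log 2 ≤ Real.log d := Real.log_le_log two_pos (by exact_mod_cast h)
      nlinarith
    · have : d = 1 := by omega
      simp [this]
  have hrest' : (18 : ℝ) ^ d * ((2 ^ d * (2 ^ d) ^ (k + 1)) * (d * (k + 1))) ≤
      256 * (2 : ℝ) ^ (16 * (d * Real.log d) + 2 * (d * k)) := by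
    have h : (18 : ℝ) ^ d * ((2 ^ d * (2 ^ d) ^ (k + 1)) * (d * (k + 1))) ≤
        2 ^ (8 * d + 2 * (d * k)) := by exact_mod_cast hrest
    refine h.trans ?_
    rw [← Real.rpow_natCast, (by norm_num : (256 : ℝ) = 2 ^ (8 : ℝ)), ← Real.rpow_add two_pos]
    apply Real.rpow_le_rpow_of_exponent_le one_le_two
    push_cast
    linarith
  have hKd : (K : ℝ) ^ d ≤ 18 ^ d * d ^ d * (1 / ε) ^ d := by
    rw [← mul_pow, ← mul_pow]
    exact pow_le_pow_left₀ (by positivity) hK d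
  push_cast
  calc (1000 : ℝ) * (n * K ^ d * (2 ^ d * (2 ^ d) ^ (k + 1)) * (d * (k + 1)))
      ≤ 1000 * (n * (18 ^ d * d ^ d * (1 / ε) ^ d) * (2 ^ d * (2 ^ d) ^ (k + 1)) *
          (d * (k + 1))) := by gcongr
    _ = 1000 * (n * (1 / ε) ^ d) * (d ^ d *
          (18 ^ d * ((2 ^ d * (2 ^ d) ^ (k + 1)) * (d * (k + 1))))) := by ring
    _ ≤ 1000 * (n * (1 / ε) ^ d) * ((2 : ℝ) ^ (2 * (d * Real.log d)) *
          (256 * (2 : ℝ) ^ (16 * (d * Real.log d) + 2 * (d * k)))) := by gcongr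
    _ = 256000 * (n * (1 / ε) ^ d * (2 : ℝ) ^ (18 * (d * Real.log d) + 2 * (d * k))) := by
        rw [(by ring : 18 * (d * Real.log d) + 2 * ((d : ℝ) * k) =
          2 * (d * Real.log d) + (16 * (d * Real.log d) + 2 * (d * k))),
          Real.rpow_add two_pos (2 * (d * Real.log d))]
        ring
    _ ≤ 256000 * (n * (1 / ε) ^ d *
          (2 : ℝ) ^ ((256000 : ℝ) * (d * Real.log d + d * k))) := by
        gcongr
        · exact one_le_two
        · linarith

theorem mainProg_spec {d n k : ℕ} {ε α : ℝ} (P : Fin n → EuclideanSpace ℝ (Fin d))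
    (hd : 1 ≤ d) (hn : 1 ≤ n) (hε : 0 < ε) (hε' : ε ≤ 1 / 5) (hα : 0 < α) :
    HT mainProg (inputMem k ε α P)
      (1000 * (n * width d ε α ^ d * (2 ^ d * (2 ^ d) ^ (k + 1)) * (d * (k + 1))))
      fun m => HoldsSkeletonAndMap m k ε α P := by
  have hX : 1 ≤ width d ε α ^ d := Nat.one_le_pow _ _ (by unfold width; omega)
  have hYZ : 2 ^ d ≤ (2 ^ d) ^ (k + 1) := Nat.le_self_pow (by omega) _
  have hbound := fun N hN => steps_le (d := d) (k := k) (N := N) hd hn hX hN Nat.one_le_two_pow hYZ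
  generalize hT : 1000 * (n * width d ε α ^ d * (2 ^ d * (2 ^ d) ^ (k + 1)) * (d * (k + 1))) = T
    at *
  -- The budget of the third phase depends on the list that the second one finds, so it cannot be
  -- fixed in advance as the rule `HT.seq` requires; the runs are joined by hand.
  obtain ⟨m₁, t₁, hr₁, ht₁, he₁, hL₁, hS₁⟩ := initProg_spec k P hd hε hα
  obtain ⟨m₂, t₂, hr₂, ht₂, L, hL₂, hlen, hmem⟩ := pixProg_spec (P := P) hd hε hα
    (fun i l => by simp [points]) he₁ hL₁
  have he₂ := he₁.frame hr₂.frame (by decide) (by decide)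
  have hS₂ : SimpRep k [] m₂ := hS₁.congr (hr₂.frame.reg _ (by decide))
    (hr₂.frame.arr _ (by decide)) (hr₂.frame.arr _ (by decide)) (hr₂.frame.arr _ (by decide))
  obtain ⟨m₃, t₃, hr₃, ht₃, hL₃, S, hS₃, hmem'⟩ := simpProg_spec he₂ hL₂ hS₂
  obtain ⟨m₄, t₄, hr₄, ht₄, h₀, h₁, hpix, harr⟩ : HT
      (.set rDim (.reg rPix) ;; .set rNum (.reg rSimp)) m₃ 10 fun m =>
      m.reg 0 = L.length ∧ m.reg 1 = S.length ∧ (∀ r, 1 < r → m.reg r = m₃.reg r) ∧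
      m.arr = m₃.arr := by
    refine HT.of_loopless rfl (by decide) ?_
    simp only [Prog.exec, Expr.eval_reg, Mem.reg_setReg, Mem.arr_setReg, hL₃.count]
    refine ⟨by simp, by simp [hS₃.count], fun r hr => ?_, trivial⟩
    rw [if_neg (by omega), if_neg (by omega)]
  refine ⟨m₄, _, .seq hr₁ (.seq hr₂ (.seq hr₃ hr₄)), ?_, ?_⟩
  · have := hbound _ hlen
    omega
  · have hL₄ : PixRep ε α L m₄ := hL₃.congr (hpix _ (by norm_num)) (by rw [harr]) (by rw [harr])
      (by rw [harr])
    have hS₄ : SimpRep k S m₄ := hS₃.congr (hpix _ (by norm_num)) (by rw [harr]) (by rw [harr])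
      (by rw [harr])
    exact holds_of_reps hd hε hε' hα hL₄ hS₄ h₀ h₁ hmem hmem'

end PixelTower

theorem mainTheorem6 :
    ∃ (prog : RealRAM.Prog) (c : ℝ),
      ∀ (d n k : ℕ) (ε α : ℝ) (P : Fin n → EuclideanSpace ℝ (Fin d)),
        1 ≤ d → 1 ≤ n → 0 < ε → ε ≤ 1 / 5 → α ∈ PixelTower.scales ε →
        ∃ (m : RealRAM.Mem) (t : ℕ),
          RealRAM.Runs prog (PixelTower.inputMem k ε α P) m t ∧
          (t : ℝ) ≤ c * (n * (1 / ε) ^ d *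
            (2 : ℝ) ^ (c * (d * Real.log d + d * k))) ∧
          PixelTower.HoldsSkeletonAndMap m k ε α P := by
  refine ⟨PixelTower.mainProg, 256000, fun d n k ε α P hd hn hε hε' hα => ?_⟩
  have hα' := PixelTower.scales_pos hε hα
  obtain ⟨m, t, hr, ht, hm⟩ := PixelTower.mainProg_spec (k := k) P hd hn hε hε' hα'
  refine ⟨m, t, hr, ?_, hm⟩
  exact (Nat.cast_le.2 ht).trans
    (PixelTower.time_le hd hε (PixelTower.width_le hd hε hε' hα'))
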